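/- Let $m\ge 2$ and let $p$ be a real number with $p\notin\{0,1,\dots,m+1\}$. Let $D\subset\mathbb R^{2m}$ be a nonempty connected open set with coordinates $(\xi_1,\dots,\xi_m,t_1,\dots,t_m)$. Write $\sigma_k$ for the $k$-th elementary symmetric function of $\xi_1,\dots,\xi_m$, $\sigma_k(\hat\xi_j)$ for that of the $\xi_i$ with $i\ne j$, and $\Delta_j=\prod_{k\ne j}(\xi_j-\xi_k)$. Let $\Theta_1,\dots,\Theta_m$ be smooth real functions of one variable, $\Theta_j$ being defined on the interval $I_j=\xi_j(D)$, and suppose that on $D$ the $\xi_j$ are pairwise distinct, $\Theta_j(\xi_j)/\Delta_j>0$ for every $j$, and $\sigma_m=\prod_j\xi_j$ has no zero. Consider on $D$ the orthotoric Kähler metric $$g=\sum_{j=1}^m\frac{\Delta_j}{\Theta_j(\xi_j)}\,d\xi_j^2+\sum_{j=1}^m\frac{\Theta_j(\xi_j)}{\Delta_j}\Big(\sum_{r=1}^m\sigma_{r-1}(\hat\xi_j)\,dt_r\Big)^2,\qquad \omega=\sum_{j=1}^m d\xi_j\wedge\Big(\sum_{r=1}^m\sigma_{r-1}(\hat\xi_j)\,dt_r\Big).$$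 A smooth function $h$ on $D$ is a Killing potential if the vector field $X$ with $\omega(X,\cdot)=-dh$ is a Killing field of $g$. For a Killing potential $f$ put $$Scal_{f,p}(g)=f^2\,Scal(g)-2(p-1)f\,\Delta_g f-p(p-1)|df|_g^2,$$ where $Scal(g)$ is the scalar curvature and $\Delta_g=-\mathrm{div}\,\mathrm{grad}$; the metric is called $(f,p)$-extremal if $Scal_{f,p}(g)$ is a Killing potential. Then $(g,\omega)$ is $(\sigma_m,p)$-extremal if and only if there are a polynomial $P$ of degree $\le m$, independent of $j$, and real constants $b_{1j},b_{2j}$ such that for every $j$ $$\Theta_j(z)=P(z)+b_{1j}|z|^{p-1}+b_{2j}|z|^{p}\qquad(z\in I_j).$$ (Here $0\notin I_j$, so $z$ has constant sign on $I_j$ and one may write $z^{p-1},z^p$ whenever these powers are defined, up to the signs of the constants.) Furthermore, whenever the $\Theta_j$ are of this form: (i) $Scal_{\sigma_m,p}(g)$ is a linear combination, with constant coefficients, of $\sigma_{m-1}$ and $\sigma_m$; (ii) $Scal_{\sigma_m,p}(g)$ is constant if and only if it vanishes identically; (iii) $Scal_{\sigma_m,p}(g)$ vanishes identically if and only if $P(0)=P'(0)=0$.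 -/

import Mathlib

open scoped ContDiff

noncomputable section

/-! ### Riemannian geometry in a coordinate domain

`ι` indexes the coordinates; a metric is given by its matrix of coefficients `g x i j`. -/

namespace CoordGeom

variable {ι : Type} [Fintype ι] [DecidableEq ι]

/-- The partial derivative `∂ u / ∂ x_i`. -/
def pd (i : ι) (u : (ι → ℝ) → ℝ) (x : ι → ℝ) : ℝ :=
  fderiv ℝ u x (Pi.single i 1)

/-- The Christoffel symbol `Γ^k_{ij}` of the Levi-Civita connection of `g`. -/
def christoffel (g : (ι → ℝ) → Matrix ι ι ℝ) (k i j : ι) (x : ι → ℝ) : ℝ :=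
  (1 / 2) * ∑ l, (g x)⁻¹ k l *
    (pd i (fun y => g y j l) x + pd j (fun y => g y i l) x - pd l (fun y => g y i j) x)

/-- The component `R^l_{kij}` of the curvature tensor:
`R(∂_i, ∂_j) ∂_k = ∑ l, R^l_{kij} ∂_l` with `R(X, Y) = [∇_X, ∇_Y] - ∇_[X, Y]`. -/
def riemann (g : (ι → ℝ) → Matrix ι ι ℝ) (l k i j : ι) (x : ι → ℝ) : ℝ :=
  pd i (christoffel g l j k) x - pd j (christoffel g l i k) x +
    ∑ n, (christoffel g l i n x * christoffel g n j k x -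
      christoffel g l j n x * christoffel g n i k x)

/-- The Ricci tensor `Ric_{jk} = ∑ i, R^i_{kij}`. -/
def ricci (g : (ι → ℝ) → Matrix ι ι ℝ) (j k : ι) (x : ι → ℝ) : ℝ :=
  ∑ i, riemann g i k i j x

/-- The scalar curvature, the `g`-trace of the Ricci tensor. -/
def scalarCurvature (g : (ι → ℝ) → Matrix ι ι ℝ) (x : ι → ℝ) : ℝ :=
  ∑ j, ∑ k, (g x)⁻¹ j k * ricci g j k x

/-- The Laplacian with the sign `Δ_g = d^* d = - div grad`. -/
def laplacian (g : (ι → ℝ) → Matrix ι ι ℝ) (u : (ι → ℝ) → ℝ) (x : ι → ℝ) : ℝ :=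
  -∑ i, ∑ j, (g x)⁻¹ i j * (pd i (pd j u) x - ∑ k, christoffel g k i j x * pd k u x)

/-- The squared norm `|du|_g ^ 2` of the differential (equivalently, of the gradient). -/
def normSqDiff (g : (ι → ℝ) → Matrix ι ι ℝ) (u : (ι → ℝ) → ℝ) (x : ι → ℝ) : ℝ :=
  ∑ i, ∑ j, (g x)⁻¹ i j * pd i u x * pd j u x

/-- The vector field `X = ∑ k, X^k ∂_k` is a Killing field of `g` on `D`: it is smooth and the Lie
derivative `L_X g` vanishes on `D`. -/
def IsKillingField (g : (ι → ℝ) → Matrix ι ι ℝ) (D : Set (ι → ℝ)) (X : ι → (ι → ℝ) → ℝ) : Prop :=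
  (∀ k, ContDiffOn ℝ ∞ (X k) D) ∧
  ∀ x ∈ D, ∀ i j,
    ∑ k, (X k x * pd k (fun y => g y i j) x + g x k j * pd i (X k) x + g x i k * pd j (X k) x) = 0

/-- `h` is a Killing potential on `D` of the Kähler structure `(g, om)`: it is smooth and is a
hamiltonian, `om(X, ·) = -dh`, of a Killing field `X` of `g`
(`X` is then `J grad_g h`, up to the sign convention relating `g`, `J` and `om`). -/
def IsKillingPotential (g om : (ι → ℝ) → Matrix ι ι ℝ) (D : Set (ι → ℝ)) (h : (ι → ℝ) → ℝ) : Prop :=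
  ContDiffOn ℝ ∞ h D ∧
  ∃ X : ι → (ι → ℝ) → ℝ, IsKillingField g D X ∧
    ∀ x ∈ D, ∀ j, ∑ i, X i x * om x i j = -pd j h x

/-- The `(f, p)`-scalar curvature
`Scal_{f,p}(g) = f² Scal(g) - 2 (p - 1) f Δ_g f - p (p - 1) |df|²_g`. -/
def weightedScal (g : (ι → ℝ) → Matrix ι ι ℝ) (f : (ι → ℝ) → ℝ) (p : ℝ) (x : ι → ℝ) : ℝ :=
  f x ^ 2 * scalarCurvature g x - 2 * (p - 1) * f x * laplacian g f x
    - p * (p - 1) * normSqDiff g f x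

/-- The Kähler structure `(g, om)` is `(f, p)`-extremal on `D`: `f` is a Killing potential, and so is
the `(f, p)`-scalar curvature. -/
def IsWeightedExtremal (g om : (ι → ℝ) → Matrix ι ι ℝ) (D : Set (ι → ℝ))
    (f : (ι → ℝ) → ℝ) (p : ℝ) : Prop :=
  IsKillingPotential g om D f ∧ IsKillingPotential g om D (weightedScal g f p)

end CoordGeom

/-! ### Orthotoric metrics

Coordinates `x : Fin m ⊕ Fin m → ℝ`, with `ξ_j = x (inl j)` and `t_r = x (inr r)`. Indices run over
`Fin m = {0, …, m - 1}`, so the coordinate with index `r : Fin m` is the `(r + 1)`-st one. -/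

namespace Orthotoric

variable {m : ℕ}

/-- Points of the coordinate space with coordinates `(ξ, t)`. -/
abbrev Pt (m : ℕ) : Type := Fin m ⊕ Fin m → ℝ

/-- The coordinates `ξ_1, …, ξ_m`. -/
def xi (x : Pt m) (j : Fin m) : ℝ := x (Sum.inl j)

/-- `σ_k`, the `k`-th elementary symmetric function of `ξ_1, …, ξ_m`. -/
def sigma (k : ℕ) (x : Pt m) : ℝ :=
  ((Finset.univ : Finset (Fin m)).val.map (xi x)).esymm k

/-- `σ_k(ξ̂_j)`, the `k`-th elementary symmetric function of the `ξ_i` with `i ≠ j`. -/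
def sigmaHat (k : ℕ) (j : Fin m) (x : Pt m) : ℝ :=
  (((Finset.univ : Finset (Fin m)).erase j).val.map (xi x)).esymm k

/-- `Δ_j = ∏_{k ≠ j} (ξ_j - ξ_k)`. -/
def Del (j : Fin m) (x : Pt m) : ℝ :=
  ∏ k ∈ Finset.univ.erase j, (xi x j - xi x k)

/-- The components of the 1-form `dξ_j`. -/
def dxi (j : Fin m) : Fin m ⊕ Fin m → ℝ
  | Sum.inl i => if i = j then 1 else 0
  | Sum.inr _ => 0

/-- The components of the 1-form `θ_j = ∑_{r=1}^m σ_{r-1}(ξ̂_j) dt_r`. -/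
def theta (j : Fin m) (x : Pt m) : Fin m ⊕ Fin m → ℝ
  | Sum.inl _ => 0
  | Sum.inr r => sigmaHat r j x

/-- `g = ∑_j (Δ_j / Θ_j(ξ_j)) dξ_j² + ∑_j (Θ_j(ξ_j) / Δ_j) θ_j²`. -/
def metric (Θ : Fin m → ℝ → ℝ) (x : Pt m) : Matrix (Fin m ⊕ Fin m) (Fin m ⊕ Fin m) ℝ :=
  Matrix.of fun a b =>
    ∑ j, Del j x / Θ j (xi x j) * (dxi j a * dxi j b) +
    ∑ j, Θ j (xi x j) / Del j x * (theta j x a * theta j x b)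

/-- `ω = ∑_j dξ_j ∧ θ_j`. -/
def kahlerForm (x : Pt m) : Matrix (Fin m ⊕ Fin m) (Fin m ⊕ Fin m) ℝ :=
  Matrix.of fun a b => ∑ j, (dxi j a * theta j x b - dxi j b * theta j x a)

/-- On `D`, each `Θ_j` has the form `P(z) + b_{1j} z^{p-1} + b_{2j} z^p`, as a function of `z = ξ_j`.
Real powers are taken of `|z|`; the `z` involved are nonzero and of constant sign for each `j`, so
for an integer `p` this is the same as using the integer powers of `z`, up to the signs of the
constants. -/
def HasForm (Θ : Fin m → ℝ → ℝ) (D : Set (Pt m)) (p : ℝ) (P : Polynomial ℝ) (b₁ b₂ : Fin m → ℝ) :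
    Prop :=
  ∀ j, ∀ z ∈ (fun x : Pt m => xi x j) '' D,
    Θ j z = P.eval z + b₁ j * |z| ^ (p - 1) + b₂ j * |z| ^ p

end Orthotoric

end

open CoordGeom Orthotoric

/-! The metric splits as a base part and a fibre part, both depending on `ξ` only, with `∂/∂t_r`
Killing. Computing its scalar curvature gives
`Scal_{σ_m,p} = -σ_m² ∑_j (L Θ_j)(ξ_j) / (ξ_j² Δ_j)`, where `L` is the Euler operator
`L φ = z² φ'' - 2 (p - 1) z φ' + p (p - 1) φ`. A Killing potential independent of `t` is an affine
combination of `σ_1, …, σ_m`, so extremality is a condition on `∑_j (L Θ_j)(ξ_j) / (ξ_j² Δ_j)`: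
fixing all `ξ_k` but one, Lagrange interpolation shows that it holds if and only if the `L Θ_j` are
one polynomial `R` of degree `≤ m`. Since `L z^k = (k - p) (k - p + 1) z^k` and `p ∉ {0, …, m + 1}`,
the equation `L φ = R` has a polynomial solution `P` of degree `≤ m`, and the kernel of `L` is
spanned by `|z| ^ (p - 1)` and `|z| ^ p`. For `L Θ_j = R` the sum reduces to a combination of
`σ_{m-1}` and `σ_m` with coefficients proportional to `P(0)` and `P'(0)`. -/

noncomputable section

open scoped Matrix

namespace CoordGeom

section DirDeriv

variable {E : Type*} [NormedAddCommGroup E] [NormedSpace ℝ E]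

/-- `u` is differentiable at `x`, with derivative `d` in the direction `v`. -/
def HasDirDeriv (v : E) (u : E → ℝ) (d : ℝ) (x : E) : Prop :=
  ∃ L : E →L[ℝ] ℝ, HasFDerivAt u L x ∧ L v = d

namespace HasDirDeriv

variable {v : E} {u w : E → ℝ} {a b : ℝ} {x : E}

theorem differentiableAt (h : HasDirDeriv v u a x) : DifferentiableAt ℝ u x :=
  h.choose_spec.1.differentiableAt

theorem const (v : E) (c : ℝ) (x : E) : HasDirDeriv v (fun _ => c) 0 x :=
  ⟨_, hasFDerivAt_const c x, by simp⟩

theorem add (hu : HasDirDeriv v u a x) (hw : HasDirDeriv v w b x) :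
    HasDirDeriv v (fun y => u y + w y) (a + b) x := by
  obtain ⟨L, hL, rfl⟩ := hu
  obtain ⟨M, hM, rfl⟩ := hw
  exact ⟨_, hL.add hM, by simp⟩

theorem mul (hu : HasDirDeriv v u a x) (hw : HasDirDeriv v w b x) :
    HasDirDeriv v (fun y => u y * w y) (a * w x + u x * b) x := by
  obtain ⟨L, hL, rfl⟩ := hu
  obtain ⟨M, hM, rfl⟩ := hw
  exact ⟨_, hL.mul hM, by simp; ring⟩

theorem comp_deriv {φ : ℝ → ℝ} (hφ : HasDerivAt φ b (u x)) (hu : HasDirDeriv v u a x) :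
    HasDirDeriv v (fun y => φ (u y)) (b * a) x := by
  obtain ⟨L, hL, rfl⟩ := hu
  exact ⟨_, hφ.comp_hasFDerivAt x hL, by simp⟩

theorem const_mul (c : ℝ) (hu : HasDirDeriv v u a x) :
    HasDirDeriv v (fun y => c * u y) (c * a) x := by
  simpa using (const v c x).mul hu

theorem sub (hu : HasDirDeriv v u a x) (hw : HasDirDeriv v w b x) :
    HasDirDeriv v (fun y => u y - w y) (a - b) x := by
  simpa [sub_eq_add_neg] using hu.add (hw.const_mul (-1))

theorem inv (hu : HasDirDeriv v u a x) (h0 : u x ≠ 0) :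
    HasDirDeriv v (fun y => (u y)⁻¹) (-(u x ^ 2)⁻¹ * a) x :=
  comp_deriv (hasDerivAt_inv h0) hu

theorem sum {κ : Type*} {s : Finset κ} {w : κ → E → ℝ} {c : κ → ℝ}
    (h : ∀ k ∈ s, HasDirDeriv v (w k) (c k) x) :
    HasDirDeriv v (fun y => ∑ k ∈ s, w k y) (∑ k ∈ s, c k) x := by
  classical
  induction s using Finset.induction_on with
  | empty => simpa using const v 0 x
  | insert k s hk ih =>
    simp only [Finset.sum_insert hk]
    exact (h k (by simp)).add (ih fun l hl => h l (by simp [hl]))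

theorem prod_log {κ : Type*} {s : Finset κ} {w : κ → E → ℝ} {c : κ → ℝ}
    (h : ∀ k ∈ s, HasDirDeriv v (w k) (w k x * c k) x) :
    HasDirDeriv v (fun y => ∏ k ∈ s, w k y) ((∏ k ∈ s, w k x) * ∑ k ∈ s, c k) x := by
  classical
  induction s using Finset.induction_on with
  | empty => simpa using const v 1 x
  | insert k s hk ih =>
    simp only [Finset.sum_insert hk, Finset.prod_insert hk]
    convert (h k (by simp)).mul (ih fun l hl => h l (by simp [hl])) using 1
    ring

theorem congr_of_eqOn {D : Set E} (hu : HasDirDeriv v u a x) (hD : IsOpen D) (hx : x ∈ D)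
    (h : Set.EqOn w u D) : HasDirDeriv v w a x := by
  obtain ⟨L, hL, rfl⟩ := hu
  exact ⟨L, hL.congr_of_eventuallyEq (h.eventuallyEq_of_mem (hD.mem_nhds hx)), rfl⟩

theorem of_line (hu : DifferentiableAt ℝ u x)
    (h : HasDerivAt (fun s : ℝ => u (x + s • v)) a 0) : HasDirDeriv v u a x := by
  refine ⟨_, hu.hasFDerivAt, ?_⟩
  have hline : HasDerivAt (fun s : ℝ => x + s • v) v 0 := by
    simpa using ((hasDerivAt_id (0 : ℝ)).smul_const v).const_add x
  have hu' : HasFDerivAt u (fderiv ℝ u x) (x + (0 : ℝ) • v) := by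
    simpa using hu.hasFDerivAt
  exact (hu'.comp_hasDerivAt 0 hline).unique h

end HasDirDeriv

end DirDeriv

section Smooth

variable {𝕜 E F : Type*} [NontriviallyNormedField 𝕜] [NormedAddCommGroup E] [NormedSpace 𝕜 E]
  [NormedAddCommGroup F] [NormedSpace 𝕜 F] {n : WithTop ℕ∞} {D : Set E}

theorem differentiableAt_of_contDiffOn {u : E → F} (hD : IsOpen D) (hn : n ≠ 0)
    (hu : ContDiffOn 𝕜 n u D) {x : E} (hx : x ∈ D) : DifferentiableAt 𝕜 u x :=
  (hu.contDiffAt (hD.mem_nhds hx)).differentiableAt hn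

variable {κ : Type*} [Fintype κ] [DecidableEq κ] {M : E → Matrix κ κ 𝕜}

theorem contDiffOn_matrix_det (hM : ∀ a b, ContDiffOn 𝕜 n (fun x => M x a b) D) :
    ContDiffOn 𝕜 n (fun x => (M x).det) D := by
  simp only [Matrix.det_apply']
  exact ContDiffOn.sum fun τ _ => contDiffOn_const.mul (contDiffOn_prod fun a _ => hM (τ a) a)

theorem contDiffOn_matrix_inv (hM : ∀ a b, ContDiffOn 𝕜 n (fun x => M x a b) D)
    (hdet : ∀ x ∈ D, IsUnit (M x).det) (a b : κ) :
    ContDiffOn 𝕜 n (fun x => (M x)⁻¹ a b) D := by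
  simp only [Matrix.inv_def, Matrix.smul_apply, Ring.inverse_eq_inv', Matrix.adjugate_apply,
    smul_eq_mul]
  refine ((contDiffOn_matrix_det hM).inv fun x hx => (hdet x hx).ne_zero).mul
    (contDiffOn_matrix_det fun c d => ?_)
  by_cases h : c = b
  · subst h
    simpa only [Matrix.updateRow_self] using contDiffOn_const
  · simpa only [Matrix.updateRow_ne h] using hM c d

end Smooth

/-- `u` is invariant under translations in the direction of `x_a`. -/
def InvariantAlong {ι α : Type*} [DecidableEq ι] (a : ι) (u : (ι → ℝ) → α) : Prop :=
  ∀ (x : ι → ℝ) (s : ℝ), u (x + s • Pi.single a 1) = u x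

variable {ι : Type} [DecidableEq ι]

theorem pd_congr_of_eqOn {i : ι} {u w : (ι → ℝ) → ℝ} {D : Set (ι → ℝ)} {x : ι → ℝ}
    (hD : IsOpen D) (hx : x ∈ D) (h : Set.EqOn w u D) : pd i w x = pd i u x := by
  rw [pd, pd, (h.eventuallyEq_of_mem (hD.mem_nhds hx)).fderiv_eq]

@[simp]
theorem pd_const (i : ι) (c : ℝ) (x : ι → ℝ) : pd i (fun _ => c) x = 0 := by
  simp [pd]

theorem pd_ite (i : ι) (q : Prop) [Decidable q] (u : (ι → ℝ) → ℝ) (x : ι → ℝ) :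
    pd i (fun y => if q then u y else 0) x = if q then pd i u x else 0 := by
  split_ifs <;> simp

section Partial

variable [Fintype ι]

/-- `u` is differentiable at `x`, with partial derivative `d` in the direction of `x_i`. -/
abbrev HasPd (i : ι) (u : (ι → ℝ) → ℝ) (d : ℝ) (x : ι → ℝ) : Prop :=
  HasDirDeriv (Pi.single i 1) u d x

theorem HasDirDeriv.pd_eq {i : ι} {u : (ι → ℝ) → ℝ} {a : ℝ} {x : ι → ℝ} (h : HasPd i u a x) :
    pd i u x = a := by
  obtain ⟨L, hL, rfl⟩ := h
  rw [pd, hL.fderiv]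

theorem hasPd_pd {u : (ι → ℝ) → ℝ} {x : ι → ℝ} (h : DifferentiableAt ℝ u x) (i : ι) :
    HasPd i u (pd i u x) x :=
  ⟨_, h.hasFDerivAt, rfl⟩

theorem hasPd_apply (i j : ι) (x : ι → ℝ) :
    HasPd i (fun y => y j) (if i = j then 1 else 0) x :=
  ⟨_, hasFDerivAt_apply j x, by simp [Pi.single_apply, eq_comm]⟩

theorem contDiffOn_pd {D : Set (ι → ℝ)} {u : (ι → ℝ) → ℝ} (hD : IsOpen D)
    (hu : ContDiffOn ℝ ∞ u D) (i : ι) : ContDiffOn ℝ ∞ (pd i u) D :=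
  (hu.fderiv_of_isOpen hD (by simp)).clm_apply contDiffOn_const

end Partial

section Finite

variable [Finite ι]

theorem exists_const_of_pd_eq_zero {D : Set (ι → ℝ)} {u : (ι → ℝ) → ℝ} (hD : IsOpen D)
    (hDc : IsPreconnected D) (hu : DifferentiableOn ℝ u D) (h : ∀ x ∈ D, ∀ i, pd i u x = 0) :
    ∃ c, ∀ x ∈ D, u x = c := by
  cases nonempty_fintype ι
  refine hD.exists_is_const_of_fderiv_eq_zero hDc (𝕜 := ℝ) hu fun x hx => ?_
  refine ContinuousLinearMap.coe_injective (LinearMap.pi_ext' fun i => LinearMap.ext_ring ?_)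
  exact h x hx i

theorem InvariantAlong.pd_eq_zero {a : ι} {u : (ι → ℝ) → ℝ} (h : InvariantAlong a u) (x : ι → ℝ) :
    pd a u x = 0 := by
  cases nonempty_fintype ι
  by_cases hu : DifferentiableAt ℝ u x
  · refine (HasDirDeriv.of_line hu ?_).pd_eq
    simp only [h x]
    exact hasDerivAt_const _ _
  · simp [pd, fderiv_zero_of_not_differentiableAt hu]

theorem InvariantAlong.pd {a : ι} {u : (ι → ℝ) → ℝ} (h : InvariantAlong a u) (i : ι) :
    InvariantAlong a (pd i u) := by
  cases nonempty_fintype ι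
  intro x s
  have := fderiv_comp_add_right (𝕜 := ℝ) (f := u) (x := x) (s • (Pi.single a 1 : ι → ℝ))
  simp only [h _ s] at this
  rw [CoordGeom.pd, CoordGeom.pd, ← this]

end Finite

variable [Fintype ι]

section Invariant

variable {a : ι} {u : (ι → ℝ) → ℝ} {g : (ι → ℝ) → Matrix ι ι ℝ}

theorem InvariantAlong.christoffel (hg : InvariantAlong a g) (k i j : ι) :
    InvariantAlong a (christoffel g k i j) := by
  intro x s
  have h : ∀ i j l, CoordGeom.pd l (fun y => g y i j) (x + s • Pi.single a 1) =
      CoordGeom.pd l (fun y => g y i j) x := fun i j l =>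
    InvariantAlong.pd (u := fun y => g y i j) (fun y r => by simp only [hg y r]) l x s
  simp only [CoordGeom.christoffel, hg x s, h]

theorem InvariantAlong.scalarCurvature (hg : InvariantAlong a g) :
    InvariantAlong a (scalarCurvature g) := by
  intro x s
  have hΓ := fun k i j => hg.christoffel k i j x s
  have hdΓ := fun l k i j => (hg.christoffel k i j).pd l x s
  simp only [CoordGeom.scalarCurvature, ricci, riemann, hg x s, hΓ, hdΓ]

theorem InvariantAlong.weightedScal (hg : InvariantAlong a g) (hu : InvariantAlong a u) (p : ℝ) :
    InvariantAlong a (weightedScal g u p) := by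
  intro x s
  have hΓ := fun k i j => hg.christoffel k i j x s
  have hdu := fun k => hu.pd k x s
  have hddu := fun k l => (hu.pd k).pd l x s
  simp only [CoordGeom.weightedScal, laplacian, normSqDiff, hg.scalarCurvature x s, hu x s,
    hg x s, hΓ, hdu, hddu]

end Invariant

section Curvature

variable {D : Set (ι → ℝ)} {g : (ι → ℝ) → Matrix ι ι ℝ}

theorem contDiffOn_christoffel (hD : IsOpen D) (hg : ∀ i j, ContDiffOn ℝ ∞ (fun y => g y i j) D)
    (hdet : ∀ x ∈ D, IsUnit (g x).det) (k i j : ι) :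
    ContDiffOn ℝ ∞ (christoffel g k i j) D := by
  have h := fun i j l => contDiffOn_pd hD (hg i j) l
  refine contDiffOn_const.mul
    (ContDiffOn.sum fun l _ => (contDiffOn_matrix_inv hg hdet k l).mul ?_)
  exact ((h _ _ _).add (h _ _ _)).sub (h _ _ _)

/-- The trace `∑ i, Γ^i_{ik}` of the Christoffel symbols; it is the logarithmic derivative in the
direction of `x_k` of the volume density of `g`. -/
def christoffelTrace (g : (ι → ℝ) → Matrix ι ι ℝ) (k : ι) (x : ι → ℝ) : ℝ :=
  ∑ i, christoffel g i i k x

theorem ricci_eq_christoffelTrace {x : ι → ℝ}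
    (hΓ : ∀ k i j, DifferentiableAt ℝ (christoffel g k i j) x) (j k : ι) :
    ricci g j k x = ∑ i, pd i (christoffel g i j k) x - pd j (christoffelTrace g k) x +
      ∑ n, christoffelTrace g n x * christoffel g n j k x -
      ∑ i, ∑ n, christoffel g i j n x * christoffel g n i k x := by
  have hpd : pd j (christoffelTrace g k) x = ∑ i, pd j (christoffel g i i k) x :=
    (HasDirDeriv.sum fun i _ => hasPd_pd (hΓ i i k) j).pd_eq
  have hmul : ∑ n, christoffelTrace g n x * christoffel g n j k x =
      ∑ i, ∑ n, christoffel g i i n x * christoffel g n j k x := by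
    simp only [christoffelTrace, Finset.sum_mul]
    exact Finset.sum_comm
  rw [hpd, hmul]
  simp only [ricci, riemann, Finset.sum_add_distrib, Finset.sum_sub_distrib]
  ring

end Curvature

end CoordGeom

namespace CoordGeom

section MatrixPd

variable {ι : Type} [DecidableEq ι] {κ : Type*}

/-- The entrywise partial derivative `∂ G / ∂ x_k` of a matrix-valued function. -/
def matrixPd (k : ι) (G : (ι → ℝ) → Matrix κ κ ℝ) (x : ι → ℝ) : Matrix κ κ ℝ :=
  Matrix.of fun a b => pd k (fun y => G y a b) x

theorem matrixPd_transpose {G : (ι → ℝ) → Matrix κ κ ℝ} (hG : ∀ x, (G x).IsSymm) (k : ι)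
    (x : ι → ℝ) : (matrixPd k G x)ᵀ = matrixPd k G x := by
  ext a b
  simp only [matrixPd, Matrix.transpose_apply, Matrix.of_apply, fun y => (hG y).apply a b]

theorem matrixPd_mul [Finite ι] [Fintype κ] {G H : (ι → ℝ) → Matrix κ κ ℝ} {x : ι → ℝ}
    (hG : ∀ a b, DifferentiableAt ℝ (fun y => G y a b) x)
    (hH : ∀ a b, DifferentiableAt ℝ (fun y => H y a b) x) (k : ι) :
    matrixPd k (fun y => G y * H y) x = matrixPd k G x * H x + G x * matrixPd k H x := by
  have := Fintype.ofFinite ι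
  ext a b
  have hsum := HasDirDeriv.sum (s := Finset.univ) fun c _ =>
    (hasPd_pd (hG a c) k).mul (hasPd_pd (hH c b) k)
  simpa [Matrix.mul_apply, matrixPd, Finset.sum_add_distrib] using hsum.pd_eq

variable [Fintype κ] [DecidableEq κ]

/-- The logarithmic partial derivative `G⁻¹ ∂ G / ∂ x_k` of a matrix-valued function. -/
def logPd (k : ι) (G : (ι → ℝ) → Matrix κ κ ℝ) (x : ι → ℝ) : Matrix κ κ ℝ :=
  (G x)⁻¹ * matrixPd k G x

theorem hasPd_matrix_inv [Fintype ι] {G : (ι → ℝ) → Matrix κ κ ℝ} {D : Set (ι → ℝ)} {x : ι → ℝ}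
    (hD : IsOpen D) (hx : x ∈ D) (hG : ∀ a b, ContDiffOn ℝ ∞ (fun y => G y a b) D)
    (hdet : ∀ y ∈ D, IsUnit (G y).det) (k : ι) (a b : κ) :
    HasPd k (fun y => (G y)⁻¹ a b) ((-(logPd k G x * (G x)⁻¹)) a b) x := by
  have hGx (c d : κ) : DifferentiableAt ℝ (fun y => G y c d) x :=
    differentiableAt_of_contDiffOn hD (by simp) (hG c d) hx
  have hinv (c d : κ) : DifferentiableAt ℝ (fun y => (G y)⁻¹ c d) x :=
    differentiableAt_of_contDiffOn hD (by simp) (contDiffOn_matrix_inv hG hdet c d) hx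
  have hmul : matrixPd k G x * (G x)⁻¹ + G x * matrixPd k (fun y => (G y)⁻¹) x = 0 := by
    rw [← matrixPd_mul hGx hinv]
    ext c d
    have hone : Set.EqOn (fun y => (G y * (G y)⁻¹) c d) (fun _ => (1 : Matrix κ κ ℝ) c d) D :=
      fun y hy => congrFun (congrFun (Matrix.mul_nonsing_inv (G y) (hdet y hy)) c) d
    exact (pd_congr_of_eqOn hD hx hone).trans (pd_const k _ x)
  have hval : matrixPd k (fun y => (G y)⁻¹) x = -(logPd k G x * (G x)⁻¹) := by
    have := congrArg ((G x)⁻¹ * ·) hmul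
    simp only [Matrix.mul_add, Matrix.nonsing_inv_mul_cancel_left _ _ (hdet x hx),
      Matrix.mul_zero] at this
    rw [logPd, Matrix.mul_assoc]
    exact eq_neg_of_add_eq_zero_right this
  rw [← hval]
  exact hasPd_pd (hinv a b) k

end MatrixPd

variable {ι κ : Type} [DecidableEq ι]

/-- The matrix of the metric `∑ i, A i dx_i² + ∑ a b, G a b dy_a dy_b` in coordinates `(x, y)`. -/
def blockMetric (A : ι → (ι ⊕ κ → ℝ) → ℝ) (G : (ι ⊕ κ → ℝ) → Matrix κ κ ℝ) (x : ι ⊕ κ → ℝ) :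
    Matrix (ι ⊕ κ) (ι ⊕ κ) ℝ :=
  Matrix.fromBlocks (Matrix.diagonal fun i => A i x) 0 0 (G x)

section Entries

variable {A : ι → (ι ⊕ κ → ℝ) → ℝ} {G : (ι ⊕ κ → ℝ) → Matrix κ κ ℝ} {x : ι ⊕ κ → ℝ}

@[simp]
theorem blockMetric_inl_inl (i j : ι) :
    blockMetric A G x (.inl i) (.inl j) = if i = j then A i x else 0 := by
  simp [blockMetric, Matrix.diagonal_apply]

@[simp]
theorem blockMetric_inl_inr (i : ι) (b : κ) : blockMetric A G x (.inl i) (.inr b) = 0 := rfl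

@[simp]
theorem blockMetric_inr_inl (a : κ) (j : ι) : blockMetric A G x (.inr a) (.inl j) = 0 := rfl

@[simp]
theorem blockMetric_inr_inr (a b : κ) : blockMetric A G x (.inr a) (.inr b) = G x a b := rfl

variable [Fintype ι] [Fintype κ] [DecidableEq κ]

theorem blockMetric_inv (hA : ∀ i, A i x ≠ 0) (hG : IsUnit (G x).det) :
    (blockMetric A G x)⁻¹ = blockMetric (fun i y => (A i y)⁻¹) (fun y => (G y)⁻¹) x := by
  refine Matrix.inv_eq_right_inv ?_
  simp [blockMetric, Matrix.fromBlocks_multiply, Matrix.mul_nonsing_inv _ hG, hA]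

theorem isUnit_det_blockMetric (hA : ∀ i, A i x ≠ 0) (hG : IsUnit (G x).det) :
    IsUnit (blockMetric A G x).det := by
  rw [blockMetric, Matrix.det_fromBlocks_zero₂₁, Matrix.det_diagonal]
  exact (isUnit_iff_ne_zero.2 <| Finset.prod_ne_zero_iff.2 fun i _ => hA i).mul hG

end Entries

variable [Fintype ι] [Fintype κ] [DecidableEq κ]

/-- On the open set `D` of the coordinate space with coordinates `(x, y)`, the functions `A` and `G`
are the coefficients of a smooth metric `∑ i, A i dx_i² + ∑ a b, G a b dy_a dy_b` of any signature,
and they do not depend on `y`. -/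
structure IsBlockMetric (A : ι → (ι ⊕ κ → ℝ) → ℝ) (G : (ι ⊕ κ → ℝ) → Matrix κ κ ℝ)
    (D : Set (ι ⊕ κ → ℝ)) : Prop where
  isOpen : IsOpen D
  contDiffOn_base : ∀ i, ContDiffOn ℝ ∞ (A i) D
  contDiffOn_fibre : ∀ a b, ContDiffOn ℝ ∞ (fun x => G x a b) D
  base_ne_zero : ∀ x ∈ D, ∀ i, A i x ≠ 0
  isUnit_det_fibre : ∀ x ∈ D, IsUnit (G x).det
  isSymm_fibre : ∀ x, (G x).IsSymm
  invariantAlong_base : ∀ c i, InvariantAlong (.inr c) (A i)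
  invariantAlong_fibre : ∀ c, InvariantAlong (.inr c) G

namespace IsBlockMetric

variable {A : ι → (ι ⊕ κ → ℝ) → ℝ} {G : (ι ⊕ κ → ℝ) → Matrix κ κ ℝ} {D : Set (ι ⊕ κ → ℝ)}
  {x : ι ⊕ κ → ℝ}

theorem hasPd (h : IsBlockMetric A G D) (hx : x ∈ D) {u : (ι ⊕ κ → ℝ) → ℝ}
    (hu : ContDiffOn ℝ ∞ u D) (i : ι ⊕ κ) : HasPd i u (pd i u x) x :=
  hasPd_pd (differentiableAt_of_contDiffOn h.isOpen (by simp) hu hx) i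

theorem inv_eq (h : IsBlockMetric A G D) (hx : x ∈ D) :
    (blockMetric A G x)⁻¹ = blockMetric (fun i y => (A i y)⁻¹) (fun y => (G y)⁻¹) x :=
  blockMetric_inv (h.base_ne_zero x hx) (h.isUnit_det_fibre x hx)

theorem contDiffOn_metric (h : IsBlockMetric A G D) (i j : ι ⊕ κ) :
    ContDiffOn ℝ ∞ (fun x => blockMetric A G x i j) D := by
  rcases i with i | a <;> rcases j with j | b <;>
    simp only [blockMetric_inl_inl, blockMetric_inl_inr, blockMetric_inr_inl, blockMetric_inr_inr]
  · split_ifs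
    exacts [h.contDiffOn_base i, contDiffOn_const]
  · exact contDiffOn_const
  · exact contDiffOn_const
  · exact h.contDiffOn_fibre a b

theorem contDiffOn_christoffel (h : IsBlockMetric A G D) (k i j : ι ⊕ κ) :
    ContDiffOn ℝ ∞ (christoffel (blockMetric A G) k i j) D :=
  CoordGeom.contDiffOn_christoffel h.isOpen h.contDiffOn_metric
    (fun x hx => isUnit_det_blockMetric (h.base_ne_zero x hx) (h.isUnit_det_fibre x hx)) k i j

theorem invariantAlong_metric (h : IsBlockMetric A G D) (c : κ) :
    InvariantAlong (.inr c) (blockMetric A G) := fun x s => by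
  simp only [blockMetric, fun i => h.invariantAlong_base c i x s, h.invariantAlong_fibre c x s]

theorem pd_inr_metric (h : IsBlockMetric A G D) (c : κ) (i j : ι ⊕ κ) (x : ι ⊕ κ → ℝ) :
    pd (.inr c) (fun y => blockMetric A G y i j) x = 0 :=
  InvariantAlong.pd_eq_zero (fun y s => by simp only [h.invariantAlong_metric c y s]) x

theorem pd_inr_fibre (h : IsBlockMetric A G D) (c a b : κ) (x : ι ⊕ κ → ℝ) :
    pd (.inr c) (fun y => G y a b) x = 0 :=
  h.pd_inr_metric c (.inr a) (.inr b) x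

section Christoffel

theorem christoffel_inl (h : IsBlockMetric A G D) (hx : x ∈ D) (k : ι) (i j : ι ⊕ κ) :
    christoffel (blockMetric A G) (.inl k) i j x =
      1 / 2 * ((A k x)⁻¹ * (pd i (fun y => blockMetric A G y j (.inl k)) x +
        pd j (fun y => blockMetric A G y i (.inl k)) x -
        pd (.inl k) (fun y => blockMetric A G y i j) x)) := by
  simp [christoffel, h.inv_eq hx, Fintype.sum_sum_type]

theorem christoffel_inr (h : IsBlockMetric A G D) (hx : x ∈ D) (a : κ) (i j : ι ⊕ κ) :
    christoffel (blockMetric A G) (.inr a) i j x =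
      1 / 2 * ∑ b, (G x)⁻¹ a b * (pd i (fun y => blockMetric A G y j (.inr b)) x +
        pd j (fun y => blockMetric A G y i (.inr b)) x) := by
  simp [christoffel, h.inv_eq hx, Fintype.sum_sum_type, h.pd_inr_metric]

theorem christoffel_inl_inl_inl (h : IsBlockMetric A G D) (hx : x ∈ D) (k i j : ι) :
    christoffel (blockMetric A G) (.inl k) (.inl i) (.inl j) x =
      1 / 2 * ((A k x)⁻¹ * ((if j = k then pd (.inl i) (A j) x else 0) +
        (if i = k then pd (.inl j) (A i) x else 0) -
        if i = j then pd (.inl k) (A i) x else 0)) := by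
  simp only [h.christoffel_inl hx, blockMetric_inl_inl, pd_ite]

theorem christoffel_inl_inl_inl_comm (h : IsBlockMetric A G D) (hx : x ∈ D) (k i j : ι) :
    christoffel (blockMetric A G) (.inl k) (.inl i) (.inl j) x =
      christoffel (blockMetric A G) (.inl k) (.inl j) (.inl i) x := by
  rcases eq_or_ne i j with rfl | hij
  · rfl
  · simp [h.christoffel_inl_inl_inl hx, hij, hij.symm, add_comm]

theorem christoffel_inl_inl_inr (h : IsBlockMetric A G D) (hx : x ∈ D) (k i : ι) (b : κ) :
    christoffel (blockMetric A G) (.inl k) (.inl i) (.inr b) x = 0 := by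
  simp [h.christoffel_inl hx, h.pd_inr_metric, -blockMetric_inl_inl]

theorem christoffel_inl_inr_inl (h : IsBlockMetric A G D) (hx : x ∈ D) (k j : ι) (a : κ) :
    christoffel (blockMetric A G) (.inl k) (.inr a) (.inl j) x = 0 := by
  simp [h.christoffel_inl hx, h.pd_inr_metric, -blockMetric_inl_inl]

theorem christoffel_inl_inr_inr (h : IsBlockMetric A G D) (hx : x ∈ D) (k : ι) (a b : κ) :
    christoffel (blockMetric A G) (.inl k) (.inr a) (.inr b) x =
      -(1 / 2) * ((A k x)⁻¹ * matrixPd (.inl k) G x a b) := by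
  simp [h.christoffel_inl hx, matrixPd]

theorem christoffel_inr_inl_inl (h : IsBlockMetric A G D) (hx : x ∈ D) (a : κ) (i j : ι) :
    christoffel (blockMetric A G) (.inr a) (.inl i) (.inl j) x = 0 := by
  simp [h.christoffel_inr hx]

theorem christoffel_inr_inl_inr (h : IsBlockMetric A G D) (hx : x ∈ D) (a : κ) (i : ι) (b : κ) :
    christoffel (blockMetric A G) (.inr a) (.inl i) (.inr b) x =
      1 / 2 * logPd (.inl i) G x a b := by
  simp only [h.christoffel_inr hx, h.pd_inr_metric, add_zero, logPd, Matrix.mul_apply,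
    blockMetric_inr_inr]
  rw [← matrixPd_transpose h.isSymm_fibre]
  rfl

theorem christoffel_inr_inr_inl (h : IsBlockMetric A G D) (hx : x ∈ D) (a b : κ) (j : ι) :
    christoffel (blockMetric A G) (.inr a) (.inr b) (.inl j) x =
      1 / 2 * logPd (.inl j) G x a b := by
  simp only [← h.christoffel_inr_inl_inr hx, h.christoffel_inr hx, add_comm]

theorem christoffel_inr_inr_inr (h : IsBlockMetric A G D) (hx : x ∈ D) (a b c : κ) :
    christoffel (blockMetric A G) (.inr a) (.inr b) (.inr c) x = 0 := by
  simp [h.christoffel_inr hx, h.pd_inr_fibre]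

theorem christoffelTrace_inl (h : IsBlockMetric A G D) (hx : x ∈ D) (k : ι) :
    christoffelTrace (blockMetric A G) (.inl k) x =
      1 / 2 * (∑ i, (A i x)⁻¹ * pd (.inl k) (A i) x + (logPd (.inl k) G x).trace) := by
  simp only [christoffelTrace, Fintype.sum_sum_type, h.christoffel_inl_inl_inl hx,
    h.christoffel_inr_inr_inl hx, ← Finset.mul_sum, mul_add]
  congr 3 with i
  by_cases hik : i = k
  · subst hik; simp
  · simp [hik, Ne.symm hik]

theorem christoffelTrace_inr (h : IsBlockMetric A G D) (hx : x ∈ D) (c : κ) :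
    christoffelTrace (blockMetric A G) (.inr c) x = 0 := by
  simp [christoffelTrace, Fintype.sum_sum_type, h.christoffel_inl_inl_inr hx,
    h.christoffel_inr_inr_inr hx]

end Christoffel

end IsBlockMetric

end CoordGeom

namespace CoordGeom.IsBlockMetric

variable {ι κ : Type} [DecidableEq ι] [Fintype ι] [Fintype κ] [DecidableEq κ]
  {A : ι → (ι ⊕ κ → ℝ) → ℝ} {G : (ι ⊕ κ → ℝ) → Matrix κ κ ℝ} {D : Set (ι ⊕ κ → ℝ)}
  {x : ι ⊕ κ → ℝ}

section Ricci

theorem ricci_eq (h : IsBlockMetric A G D) (hx : x ∈ D) (j k : ι ⊕ κ) :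
    ricci (blockMetric A G) j k x =
      ∑ i, pd i (christoffel (blockMetric A G) i j k) x -
      pd j (christoffelTrace (blockMetric A G) k) x +
      ∑ n, christoffelTrace (blockMetric A G) (.inl n) x *
        christoffel (blockMetric A G) (.inl n) j k x -
      ∑ i, ∑ n, christoffel (blockMetric A G) i j n x * christoffel (blockMetric A G) n i k x := by
  rw [ricci_eq_christoffelTrace fun k i j =>
    differentiableAt_of_contDiffOn h.isOpen (by simp) (h.contDiffOn_christoffel k i j) hx]
  simp [Fintype.sum_sum_type, h.christoffelTrace_inr hx]

theorem sum_pd_christoffel (h : IsBlockMetric A G D) (j k : ι ⊕ κ) (x : ι ⊕ κ → ℝ) :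
    ∑ i, pd i (christoffel (blockMetric A G) i j k) x =
      ∑ i, pd (.inl i) (christoffel (blockMetric A G) (.inl i) j k) x := by
  simp [Fintype.sum_sum_type, fun c =>
    ((h.invariantAlong_metric c).christoffel (.inr c) j k).pd_eq_zero x]

theorem ricci_inl_inl (h : IsBlockMetric A G D) (hx : x ∈ D) (j : ι) :
    ricci (blockMetric A G) (.inl j) (.inl j) x =
      ∑ i, pd (.inl i) (christoffel (blockMetric A G) (.inl i) (.inl j) (.inl j)) x -
      pd (.inl j) (christoffelTrace (blockMetric A G) (.inl j)) x +
      ∑ n, christoffelTrace (blockMetric A G) (.inl n) x *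
        christoffel (blockMetric A G) (.inl n) (.inl j) (.inl j) x -
      ∑ i, ∑ n, christoffel (blockMetric A G) (.inl i) (.inl j) (.inl n) x *
        christoffel (blockMetric A G) (.inl n) (.inl i) (.inl j) x -
      1 / 4 * (logPd (.inl j) G x ^ 2).trace := by
  rw [h.ricci_eq hx, h.sum_pd_christoffel, sub_sub _ _ (1 / 4 * _)]
  congr 1
  simp only [Fintype.sum_sum_type, h.christoffel_inl_inl_inr hx, h.christoffel_inr_inl_inl hx,
    h.christoffel_inr_inl_inr hx, h.christoffel_inr_inr_inl hx, zero_mul, Finset.sum_const_zero,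
    add_zero, zero_add, sq, Matrix.trace, Matrix.diag_apply, Matrix.mul_apply, Finset.mul_sum]
  congr! 3
  ring

theorem pd_christoffel_inl_inr_inr (h : IsBlockMetric A G D) (hx : x ∈ D) (k : ι) (a b : κ) :
    pd (.inl k) (christoffel (blockMetric A G) (.inl k) (.inr a) (.inr b)) x =
      -(1 / 2) * pd (.inl k) (fun y => (A k y)⁻¹ * matrixPd (.inl k) G y a b) x := by
  refine (HasDirDeriv.congr_of_eqOn (.const_mul _ (h.hasPd hx ?_ _)) h.isOpen hx fun y hy =>
    h.christoffel_inl_inr_inr hy k a b).pd_eq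
  exact ((h.contDiffOn_base k).inv fun y hy => h.base_ne_zero y hy k).mul
    (contDiffOn_pd h.isOpen (h.contDiffOn_fibre a b) _)

theorem sum_christoffel_mul_inr_inr (h : IsBlockMetric A G D) (hx : x ∈ D) (a b : κ) :
    ∑ i, ∑ n, christoffel (blockMetric A G) i (.inr a) n x *
        christoffel (blockMetric A G) n i (.inr b) x =
      -(1 / 2) * ∑ k, (A k x)⁻¹ * (matrixPd (.inl k) G x * logPd (.inl k) G x) a b := by
  have hsymm (k : ι) : (logPd (.inl k) G x)ᵀ * matrixPd (.inl k) G x =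
      matrixPd (.inl k) G x * logPd (.inl k) G x := by
    rw [logPd, Matrix.transpose_mul, matrixPd_transpose h.isSymm_fibre,
      Matrix.transpose_nonsing_inv, h.isSymm_fibre x, Matrix.mul_assoc]
  have hentry (k : ι) :
      ∑ c, matrixPd (.inl k) G x a c * logPd (.inl k) G x c b =
        ∑ c, logPd (.inl k) G x c a * matrixPd (.inl k) G x c b := by
    simpa [Matrix.mul_apply] using (congrFun₂ (hsymm k) a b).symm
  simp only [Fintype.sum_sum_type, h.christoffel_inl_inr_inl hx, h.christoffel_inl_inl_inr hx,
    h.christoffel_inr_inr_inr hx, h.christoffel_inl_inr_inr hx, h.christoffel_inr_inl_inr hx,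
    h.christoffel_inr_inr_inl hx, zero_mul, Finset.sum_const_zero, zero_add, add_zero,
    Matrix.mul_apply]
  rw [Finset.sum_comm (s := (Finset.univ : Finset κ)), ← Finset.sum_add_distrib, Finset.mul_sum]
  refine Finset.sum_congr rfl fun k _ => ?_
  calc _ = -(1 / 4) * ((A k x)⁻¹ * ∑ c, matrixPd (.inl k) G x a c * logPd (.inl k) G x c b) +
        -(1 / 4) * ((A k x)⁻¹ * ∑ c, logPd (.inl k) G x c a * matrixPd (.inl k) G x c b) := by
        simp only [Finset.mul_sum]
        congr! 2 <;> ring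
    _ = _ := by rw [← hentry]; ring

theorem ricci_inr_inr (h : IsBlockMetric A G D) (hx : x ∈ D) (a b : κ) :
    ricci (blockMetric A G) (.inr a) (.inr b) x =
      -(1 / 2) * ∑ k, (pd (.inl k) (fun y => (A k y)⁻¹ * matrixPd (.inl k) G y a b) x +
        christoffelTrace (blockMetric A G) (.inl k) x * ((A k x)⁻¹ * matrixPd (.inl k) G x a b) -
        (A k x)⁻¹ * (matrixPd (.inl k) G x * logPd (.inl k) G x) a b) := by
  have htrace : pd (.inr a) (christoffelTrace (blockMetric A G) (.inr b)) x = 0 := by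
    rw [pd_congr_of_eqOn h.isOpen hx fun y hy => h.christoffelTrace_inr hy b, pd_const]
  simp only [h.ricci_eq hx, h.sum_pd_christoffel, h.pd_christoffel_inl_inr_inr hx, htrace,
    h.christoffel_inl_inr_inr hx, h.sum_christoffel_mul_inr_inr hx, Finset.sum_add_distrib,
    Finset.sum_sub_distrib, mul_left_comm _ (-(1 / 2) : ℝ), ← Finset.mul_sum]
  ring

/-- The term in `tr L_k²`, `L_k = G⁻¹ ∂_k G`, produced by differentiating `G⁻¹` is the one that
cancels the quadratic terms of the Ricci tensor. -/
theorem pd_inv_mul_trace_logPd (h : IsBlockMetric A G D) (hx : x ∈ D) (k : ι) :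
    pd (.inl k) (fun y => (A k y)⁻¹ * (logPd (.inl k) G y).trace) x =
      ∑ a, ∑ b, (G x)⁻¹ a b * (pd (.inl k) (fun y => (A k y)⁻¹ * matrixPd (.inl k) G y b a) x -
        (A k x)⁻¹ * (matrixPd (.inl k) G x * logPd (.inl k) G x) b a) := by
  have hfun : (fun y => (A k y)⁻¹ * (logPd (.inl k) G y).trace) = fun y =>
      ∑ a, ∑ b, (G y)⁻¹ a b * ((A k y)⁻¹ * matrixPd (.inl k) G y b a) := by
    funext y
    simp only [logPd, Matrix.trace, Matrix.diag_apply, Matrix.mul_apply, Finset.mul_sum]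
    congr! 2
    ring
  have hsmooth (a b : κ) : ContDiffOn ℝ ∞ (fun y => (A k y)⁻¹ * matrixPd (.inl k) G y b a) D :=
    ((h.contDiffOn_base k).inv fun y hy => h.base_ne_zero y hy k).mul
      (contDiffOn_pd h.isOpen (h.contDiffOn_fibre b a) _)
  have hpd := (HasDirDeriv.sum fun a (_ : a ∈ Finset.univ) =>
    .sum fun b (_ : b ∈ Finset.univ) =>
      (hasPd_matrix_inv h.isOpen hx h.contDiffOn_fibre h.isUnit_det_fibre (.inl k) a b).mul
        (h.hasPd hx (hsmooth a b) (.inl k))).pd_eq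
  have hquad : ∑ a, ∑ b, (logPd (.inl k) G x * (G x)⁻¹) a b * matrixPd (.inl k) G x b a =
      ∑ a, ∑ b, (G x)⁻¹ a b * (matrixPd (.inl k) G x * logPd (.inl k) G x) b a := by
    simp only [← Matrix.mul_apply, ← Matrix.diag_apply (_ * _)]
    change Matrix.trace _ = Matrix.trace _
    simp only [Matrix.mul_assoc, logPd]
  rw [hfun, hpd]
  simp only [Matrix.neg_apply, mul_sub, Finset.sum_add_distrib, Finset.sum_sub_distrib, neg_mul,
    Finset.sum_neg_distrib, mul_left_comm _ (A k x)⁻¹, ← Finset.mul_sum, hquad]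
  ring

theorem sum_inv_mul_ricci_inr_inr (h : IsBlockMetric A G D) (hx : x ∈ D) :
    ∑ a, ∑ b, (G x)⁻¹ a b * ricci (blockMetric A G) (.inr a) (.inr b) x =
      -(1 / 2) * ∑ k, (pd (.inl k) (fun y => (A k y)⁻¹ * (logPd (.inl k) G y).trace) x +
        christoffelTrace (blockMetric A G) (.inl k) x *
          ((A k x)⁻¹ * (logPd (.inl k) G x).trace)) := by
  have hsymm (a b : κ) : (G x)⁻¹ a b = (G x)⁻¹ b a := by
    rw [← Matrix.transpose_apply (G x)⁻¹, Matrix.transpose_nonsing_inv, h.isSymm_fibre x]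
  have htrace (k : ι) : (A k x)⁻¹ * (logPd (.inl k) G x).trace =
      ∑ a, ∑ b, (G x)⁻¹ a b * ((A k x)⁻¹ * matrixPd (.inl k) G x b a) := by
    simp only [logPd, Matrix.trace, Matrix.diag_apply, Matrix.mul_apply, Finset.mul_sum,
      mul_left_comm]
  calc ∑ a, ∑ b, (G x)⁻¹ a b * ricci (blockMetric A G) (.inr a) (.inr b) x
      = ∑ a, ∑ b, (G x)⁻¹ a b * ricci (blockMetric A G) (.inr b) (.inr a) x := by
        rw [Finset.sum_comm]
        simp only [hsymm]
    _ = -(1 / 2) * ∑ a, ∑ b, ∑ k, (G x)⁻¹ a b *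
          (pd (.inl k) (fun y => (A k y)⁻¹ * matrixPd (.inl k) G y b a) x +
          christoffelTrace (blockMetric A G) (.inl k) x * ((A k x)⁻¹ * matrixPd (.inl k) G x b a) -
          (A k x)⁻¹ * (matrixPd (.inl k) G x * logPd (.inl k) G x) b a) := by
        simp only [h.ricci_inr_inr hx, mul_left_comm _ (-(1 / 2) : ℝ), Finset.mul_sum]
    _ = _ := by
        rw [Finset.sum_congr rfl fun a _ => Finset.sum_comm, Finset.sum_comm]
        refine congrArg _ (Finset.sum_congr rfl fun k _ => ?_)
        rw [h.pd_inv_mul_trace_logPd hx, htrace]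
        simp only [Finset.mul_sum, ← Finset.sum_add_distrib]
        congr! 2
        ring

theorem scalarCurvature_eq (h : IsBlockMetric A G D) (hx : x ∈ D) :
    scalarCurvature (blockMetric A G) x =
      ∑ i, (A i x)⁻¹ * ricci (blockMetric A G) (.inl i) (.inl i) x +
      ∑ a, ∑ b, (G x)⁻¹ a b * ricci (blockMetric A G) (.inr a) (.inr b) x := by
  simp [scalarCurvature, h.inv_eq hx, Fintype.sum_sum_type]

end Ricci

section InvariantFunctions

variable {u : (ι ⊕ κ → ℝ) → ℝ}

theorem normSqDiff_eq (h : IsBlockMetric A G D) (hx : x ∈ D)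
    (hu : ∀ c : κ, InvariantAlong (.inr c) u) :
    normSqDiff (blockMetric A G) u x = ∑ k, (A k x)⁻¹ * pd (.inl k) u x ^ 2 := by
  simp [normSqDiff, h.inv_eq hx, Fintype.sum_sum_type, fun c => (hu c).pd_eq_zero x, sq, mul_assoc]

theorem sum_inv_mul_christoffel_inl (h : IsBlockMetric A G D) (hx : x ∈ D) (k : ι) :
    ∑ i, (A i x)⁻¹ * christoffel (blockMetric A G) (.inl k) (.inl i) (.inl i) x =
      (A k x ^ 2)⁻¹ * pd (.inl k) (A k) x -
        1 / 2 * ((A k x)⁻¹ * ∑ i, (A i x)⁻¹ * pd (.inl k) (A i) x) := by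
  simp only [h.christoffel_inl_inl_inl hx, if_true, mul_sub, mul_add, Finset.sum_sub_distrib,
    Finset.sum_add_distrib, mul_ite, mul_zero, Finset.sum_ite_eq', Finset.mem_univ, Finset.mul_sum]
  congr 1
  · field
  · exact Finset.sum_congr rfl fun i _ => by ring

theorem sum_inv_mul_christoffel_inr (h : IsBlockMetric A G D) (hx : x ∈ D) (k : ι) :
    ∑ a, ∑ b, (G x)⁻¹ a b * christoffel (blockMetric A G) (.inl k) (.inr a) (.inr b) x =
      -(1 / 2) * ((A k x)⁻¹ * (logPd (.inl k) G x).trace) := by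
  simp only [h.christoffel_inl_inr_inr hx, logPd, Matrix.trace, Matrix.diag_apply,
    Matrix.mul_apply, Finset.mul_sum]
  refine Finset.sum_congr rfl fun a _ => Finset.sum_congr rfl fun b _ => ?_
  rw [← Matrix.transpose_apply (matrixPd _ _ _), matrixPd_transpose h.isSymm_fibre]
  ring

theorem laplacian_eq_sum_christoffel (h : IsBlockMetric A G D) (hx : x ∈ D)
    (hu : ∀ c : κ, InvariantAlong (.inr c) u) :
    laplacian (blockMetric A G) u x =
      -∑ k, ((A k x)⁻¹ * pd (.inl k) (pd (.inl k) u) x -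
        (∑ i, (A i x)⁻¹ * christoffel (blockMetric A G) (.inl k) (.inl i) (.inl i) x +
          ∑ a, ∑ b, (G x)⁻¹ a b * christoffel (blockMetric A G) (.inl k) (.inr a) (.inr b) x) *
        pd (.inl k) u x) := by
  have hfirst (a b : ι ⊕ κ) :
      ∑ k, christoffel (blockMetric A G) k a b x * pd k u x =
        ∑ k, christoffel (blockMetric A G) (.inl k) a b x * pd (.inl k) u x := by
    simp [Fintype.sum_sum_type, fun c => (hu c).pd_eq_zero x]
  have hsecond (c d : κ) : pd (.inr c) (pd (.inr d) u) x = 0 := ((hu c).pd _).pd_eq_zero x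
  have hbase : ∑ k, (∑ i, (A i x)⁻¹ *
        christoffel (blockMetric A G) (.inl k) (.inl i) (.inl i) x) * pd (.inl k) u x =
      ∑ i, (A i x)⁻¹ * ∑ k,
        christoffel (blockMetric A G) (.inl k) (.inl i) (.inl i) x * pd (.inl k) u x := by
    simp only [Finset.sum_mul, Finset.mul_sum, mul_assoc]
    exact Finset.sum_comm
  have hfibre : ∑ k, (∑ a, ∑ b, (G x)⁻¹ a b *
        christoffel (blockMetric A G) (.inl k) (.inr a) (.inr b) x) * pd (.inl k) u x =
      ∑ a, ∑ b, (G x)⁻¹ a b * ∑ k,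
        christoffel (blockMetric A G) (.inl k) (.inr a) (.inr b) x * pd (.inl k) u x := by
    simp only [Finset.sum_mul, Finset.mul_sum, mul_assoc]
    rw [Finset.sum_comm]
    exact Finset.sum_congr rfl fun a _ => Finset.sum_comm
  simp only [add_mul, Finset.sum_add_distrib, Finset.sum_sub_distrib, hbase, hfibre]
  simp only [laplacian, h.inv_eq hx, hfirst, Fintype.sum_sum_type, hsecond]
  simp [sub_eq_add_neg, add_assoc, add_comm, mul_add, Finset.sum_add_distrib]

theorem laplacian_eq (h : IsBlockMetric A G D) (hx : x ∈ D)
    (hu : ∀ c : κ, InvariantAlong (.inr c) u) :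
    laplacian (blockMetric A G) u x =
      -∑ k, ((A k x)⁻¹ * pd (.inl k) (pd (.inl k) u) x +
        (pd (.inl k) (fun y => (A k y)⁻¹) x +
          christoffelTrace (blockMetric A G) (.inl k) x * (A k x)⁻¹) * pd (.inl k) u x) := by
  rw [h.laplacian_eq_sum_christoffel hx hu]
  congr! 2 with k
  have hinv : pd (.inl k) (fun y => (A k y)⁻¹) x = -(A k x ^ 2)⁻¹ * pd (.inl k) (A k) x :=
    (HasDirDeriv.inv (h.hasPd hx (h.contDiffOn_base k) _) (h.base_ne_zero x hx k)).pd_eq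
  rw [hinv, h.christoffelTrace_inl hx, h.sum_inv_mul_christoffel_inl hx,
    h.sum_inv_mul_christoffel_inr hx]
  ring

end InvariantFunctions

end CoordGeom.IsBlockMetric

namespace Orthotoric

theorem esymm_map_insert {σ R : Type*} [DecidableEq σ] [CommSemiring R] (f : σ → R)
    {s : Finset σ} {a : σ} (ha : a ∉ s) (r : ℕ) :
    ((insert a s).val.map f).esymm (r + 1) =
      (s.val.map f).esymm (r + 1) + f a * (s.val.map f).esymm r := by
  rw [Finset.insert_val_of_notMem ha, Multiset.map_cons, Multiset.esymm,
    Multiset.powersetCard_cons, Multiset.map_add, Multiset.sum_add, Multiset.map_map]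
  simp [Multiset.esymm, Multiset.sum_map_mul_left]

variable {m : ℕ}

theorem xi_add_inr (x : Pt m) (a : Fin m) (s : ℝ) :
    xi (x + s • Pi.single (Sum.inr a) 1) = xi x := by
  ext j
  simp [xi]

theorem xi_add_inl (x : Pt m) (i j : Fin m) (s : ℝ) :
    xi (x + s • Pi.single (Sum.inl i) 1) j = xi x j + if j = i then s else 0 := by
  simp [xi, Pi.single_apply]

theorem contDiff_xi (j : Fin m) : ContDiff ℝ ∞ (fun x : Pt m => xi x j) := by
  unfold xi
  fun_prop

theorem contDiff_esymm (s : Finset (Fin m)) (r : ℕ) :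
    ContDiff ℝ ∞ (fun x : Pt m => (s.val.map (xi x)).esymm r) := by
  simp only [Finset.esymm_map_val]
  exact ContDiff.sum fun t _ => contDiff_prod fun j _ => contDiff_xi j

theorem contDiff_sigma (r : ℕ) : ContDiff ℝ ∞ (sigma r : Pt m → ℝ) := contDiff_esymm _ _

theorem contDiff_sigmaHat (r : ℕ) (j : Fin m) : ContDiff ℝ ∞ (sigmaHat r j : Pt m → ℝ) :=
  contDiff_esymm _ _

theorem contDiff_Del (j : Fin m) : ContDiff ℝ ∞ (Del j : Pt m → ℝ) :=
  contDiff_prod fun k _ => (contDiff_xi j).sub (contDiff_xi k)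

theorem hasPd_xi (k j : Fin m) (x : Pt m) :
    HasPd (Sum.inl k) (fun y => xi y j) (if k = j then 1 else 0) x := by
  simpa [xi, eq_comm] using hasPd_apply (Sum.inl k) (Sum.inl j) x

theorem hasPd_esymm_of_notMem {s : Finset (Fin m)} {k : Fin m} (hk : k ∉ s) (r : ℕ) (x : Pt m) :
    HasPd (Sum.inl k) (fun y : Pt m => (s.val.map (xi y)).esymm r) 0 x := by
  refine HasDirDeriv.of_line ((contDiff_esymm s r).differentiable (by simp) x) ?_
  have h : ∀ t : ℝ, s.val.map (xi (x + t • Pi.single (Sum.inl k) 1)) = s.val.map (xi x) :=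
    fun t => Multiset.map_congr rfl fun j hj => by
      have hjk : j ≠ k := fun h => hk (h ▸ hj)
      simp [xi_add_inl, hjk]
  simp only [h]
  exact hasDerivAt_const _ _

theorem hasPd_esymm_of_mem {s : Finset (Fin m)} {k : Fin m} (hk : k ∈ s) (r : ℕ) (x : Pt m) :
    HasPd (Sum.inl k) (fun y : Pt m => (s.val.map (xi y)).esymm (r + 1))
      (((s.erase k).val.map (xi x)).esymm r) x := by
  have h : ∀ y : Pt m, (s.val.map (xi y)).esymm (r + 1) = ((s.erase k).val.map (xi y)).esymm (r + 1)
      + xi y k * ((s.erase k).val.map (xi y)).esymm r := fun y => by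
    conv_lhs => rw [← Finset.insert_erase hk]
    exact esymm_map_insert _ (Finset.notMem_erase k s) r
  simp only [h]
  simpa using (hasPd_esymm_of_notMem (Finset.notMem_erase k s) _ x).add ((hasPd_xi k k x).mul
    (hasPd_esymm_of_notMem (Finset.notMem_erase k s) _ x))

theorem hasPd_sigma (r : ℕ) (k : Fin m) (x : Pt m) :
    HasPd (Sum.inl k) (sigma (r + 1)) (sigmaHat r k x) x :=
  hasPd_esymm_of_mem (Finset.mem_univ k) r x

@[simp]
theorem sigmaHat_zero (j : Fin m) (x : Pt m) : sigmaHat 0 j x = 1 := by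
  simp [sigmaHat, Multiset.esymm]

theorem sigma_succ_eq (r : ℕ) (j : Fin m) (x : Pt m) :
    sigma (r + 1) x = sigmaHat (r + 1) j x + xi x j * sigmaHat r j x := by
  rw [sigma, ← Finset.insert_erase (Finset.mem_univ j),
    esymm_map_insert _ (Finset.notMem_erase j Finset.univ)]
  rfl

theorem sigmaHat_sub_sigmaHat {j k : Fin m} (hjk : j ≠ k) (r : ℕ) (x : Pt m) :
    sigmaHat (r + 1) j x - sigmaHat (r + 1) k x =
      (xi x k - xi x j) * ((((Finset.univ.erase j).erase k).val.map (xi x)).esymm r) := by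
  have hj : Finset.univ.erase j = insert k ((Finset.univ.erase j).erase k) :=
    (Finset.insert_erase (by simp [hjk.symm])).symm
  have hk : Finset.univ.erase k = insert j ((Finset.univ.erase j).erase k) := by
    rw [Finset.erase_right_comm]
    exact (Finset.insert_erase (by simp [hjk])).symm
  rw [sigmaHat, sigmaHat, hk]
  conv_lhs => enter [1]; rw [hj]
  rw [esymm_map_insert _ (by simp), esymm_map_insert _ (by simp)]
  ring

theorem hasPd_sigmaHat {x : Pt m} (hx : Function.Injective (xi x)) (r : ℕ) (j k : Fin m) :
    HasPd (Sum.inl k) (sigmaHat r j)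
      ((xi x k - xi x j)⁻¹ * (sigmaHat r j x - sigmaHat r k x)) x := by
  rcases r with _ | r
  · have h : (sigmaHat 0 j : Pt m → ℝ) = fun _ => 1 := funext (sigmaHat_zero j)
    simpa [h, sigmaHat_zero] using HasDirDeriv.const (Pi.single (Sum.inl k) 1) 1 x
  by_cases hjk : j = k
  · subst hjk
    rw [sub_self, inv_zero, zero_mul]
    exact hasPd_esymm_of_notMem (Finset.notMem_erase j Finset.univ) (r + 1) x
  · have h0 : xi x k - xi x j ≠ 0 := sub_ne_zero.2 fun h => hjk (hx h).symm
    rw [sigmaHat_sub_sigmaHat hjk, inv_mul_cancel_left₀ h0]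
    exact hasPd_esymm_of_mem (Finset.mem_erase.2 ⟨Ne.symm hjk, Finset.mem_univ k⟩) r x

/-- `∑_{l ≠ j} 1 / (ξ_j - ξ_l)`, the logarithmic derivative of `Δ_j` in `ξ_j`; the term with
`l = j` is `0⁻¹ = 0`. -/
def sumInv (x : Pt m) (j : Fin m) : ℝ := ∑ l, (xi x j - xi x l)⁻¹

theorem Del_ne_zero {x : Pt m} (hx : Function.Injective (xi x)) (j : Fin m) : Del j x ≠ 0 :=
  Finset.prod_ne_zero_iff.2 fun _ hk =>
    sub_ne_zero.2 fun h => (Finset.ne_of_mem_erase hk) (hx h).symm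

theorem hasPd_Del {x : Pt m} (hx : Function.Injective (xi x)) (j k : Fin m) :
    HasPd (Sum.inl k) (Del j)
      (Del j x * ((xi x k - xi x j)⁻¹ + if k = j then sumInv x j else 0)) x := by
  have h : ∀ l ∈ Finset.univ.erase j, HasPd (Sum.inl k) (fun y : Pt m => xi y j - xi y l)
      ((xi x j - xi x l) * (((if k = j then 1 else 0) - if k = l then 1 else 0)
        * (xi x j - xi x l)⁻¹)) x := by
    intro l hl
    have h0 : xi x j - xi x l ≠ 0 := sub_ne_zero.2 fun h => (Finset.ne_of_mem_erase hl) (hx h).symm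
    convert (hasPd_xi k j x).sub (hasPd_xi k l x) using 1
    field_simp
  have hval : (xi x k - xi x j)⁻¹ + (if k = j then sumInv x j else 0) =
      ∑ l ∈ Finset.univ.erase j,
        ((if k = j then 1 else 0) - if k = l then 1 else 0) * (xi x j - xi x l)⁻¹ := by
    rw [Finset.sum_erase _ (by simp)]
    simp only [sub_mul, Finset.sum_sub_distrib, ite_mul, one_mul, zero_mul, sumInv]
    rw [Finset.sum_ite_eq Finset.univ k, ← neg_sub (xi x k) (xi x j), inv_neg]
    by_cases hkj : k = j <;> simp [hkj]
  rw [hval]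
  exact HasDirDeriv.prod_log h

/-- The inverse of the matrix `σ_{r-1}(ξ̂_j)`. -/
def sigmaInv (x : Pt m) : Matrix (Fin m) (Fin m) ℝ :=
  Matrix.of fun r j => (-1) ^ (r : ℕ) * xi x j ^ (m - 1 - r) / Del j x

/-- The matrix `σ_{r-1}(ξ̂_j)`. -/
def sigmaMat (x : Pt m) : Matrix (Fin m) (Fin m) ℝ := Matrix.of fun j r => sigmaHat r j x

theorem sum_sigmaHat_mul_pow (x : Pt m) (j : Fin m) (z : ℝ) :
    ∑ r : Fin m, sigmaHat r j x * ((-1) ^ (r : ℕ) * z ^ (m - 1 - r)) =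
      ∏ k ∈ Finset.univ.erase j, (z - xi x k) := by
  have hm : 0 < m := j.pos
  have h := congrArg (Polynomial.eval z)
    (Multiset.prod_X_sub_X_eq_sum_esymm ((Finset.univ.erase j).val.map (xi x)))
  have hcard : Multiset.card ((Finset.univ.erase j).val.map (xi x)) = m - 1 := by
    rw [Multiset.card_map, Finset.card_val, Finset.card_erase_of_mem (Finset.mem_univ j)]
    simp
  rw [hcard, Nat.sub_add_cancel hm, Multiset.map_map, Polynomial.eval_finsetSum,
    Finset.sum_range] at h
  have hprod : (Multiset.map ((fun t => Polynomial.X - Polynomial.C t) ∘ xi x)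
      (Finset.univ.erase j).val).prod = ∏ k ∈ Finset.univ.erase j,
        (Polynomial.X - Polynomial.C (xi x k)) := rfl
  rw [hprod, Polynomial.eval_prod] at h
  simp only [Polynomial.eval_sub, Polynomial.eval_X, Polynomial.eval_C] at h
  rw [h]
  refine Finset.sum_congr rfl fun r _ => ?_
  simp [sigmaHat]
  ring

theorem sigmaMat_mul_sigmaInv {x : Pt m} (hx : Function.Injective (xi x)) :
    sigmaMat x * sigmaInv x = 1 := by
  ext i j
  have h : ∑ r : Fin m, sigmaHat r i x * ((-1) ^ (r : ℕ) * xi x j ^ (m - 1 - r) / Del j x) =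
      (∏ k ∈ Finset.univ.erase i, (xi x j - xi x k)) / Del j x := by
    rw [← sum_sigmaHat_mul_pow, Finset.sum_div]
    exact Finset.sum_congr rfl fun r _ => by ring
  simp only [Matrix.mul_apply, sigmaMat, sigmaInv, Matrix.of_apply, h, Matrix.one_apply]
  split_ifs with hij
  · subst hij
    exact div_self (Del_ne_zero hx i)
  · rw [Finset.prod_eq_zero (Finset.mem_erase.2 ⟨fun h => hij h.symm, Finset.mem_univ j⟩)
      (sub_self _), zero_div]

theorem sigmaInv_mul_sigmaMat {x : Pt m} (hx : Function.Injective (xi x)) :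
    sigmaInv x * sigmaMat x = 1 :=
  mul_eq_one_comm.1 (sigmaMat_mul_sigmaInv hx)

theorem eq_zero_of_sum_sigmaHat {x : Pt m} (hx : Function.Injective (xi x)) {c : Fin m → ℝ}
    (h : ∀ j, ∑ r : Fin m, c r * sigmaHat r j x = 0) (r : Fin m) : c r = 0 := by
  have hc : sigmaMat x *ᵥ c = 0 := by
    ext j
    simpa [Matrix.mulVec, dotProduct, sigmaMat, mul_comm] using h j
  rw [← Matrix.one_mulVec c, ← sigmaInv_mul_sigmaMat hx, ← Matrix.mulVec_mulVec, hc,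
    Matrix.mulVec_zero, Pi.zero_apply]

theorem sigma_top (x : Pt m) : sigma m x = ∏ j, xi x j := by
  have h : (Finset.univ : Finset (Fin m)).powersetCard m = {Finset.univ} := by
    have := Finset.powersetCard_self (Finset.univ : Finset (Fin m))
    rwa [Finset.card_fin] at this
  rw [sigma, Finset.esymm_map_val, h, Finset.sum_singleton]

theorem sigmaHat_top (j : Fin m) (x : Pt m) :
    sigmaHat (m - 1) j x = ∏ k ∈ Finset.univ.erase j, xi x k := by
  have h : m - 1 = (Finset.univ.erase j).card := by
    rw [Finset.card_erase_of_mem (Finset.mem_univ j), Finset.card_fin]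
  rw [sigmaHat, Finset.esymm_map_val, h, Finset.powersetCard_self, Finset.sum_singleton]

theorem xi_mul_sigmaHat_top (j : Fin m) (x : Pt m) : xi x j * sigmaHat (m - 1) j x = sigma m x := by
  rw [sigma_top, sigmaHat_top, Finset.mul_prod_erase _ _ (Finset.mem_univ j)]

theorem xi_ne_zero {x : Pt m} (hx : sigma m x ≠ 0) (j : Fin m) : xi x j ≠ 0 := fun h0 => by
  rw [← xi_mul_sigmaHat_top j, h0, zero_mul] at hx
  exact hx rfl

theorem hasPd_sigma_top (j : Fin m) (x : Pt m) :
    HasPd (Sum.inl j) (sigma m) (sigmaHat (m - 1) j x) x := by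
  have h := hasPd_sigma (m - 1) j x
  rwa [Nat.sub_add_cancel j.pos] at h

theorem sum_eval_div_Del {x : Pt m} (hx : Function.Injective (xi x)) {P : Polynomial ℝ}
    (hP : P.degree < (m - 1 : ℕ)) : ∑ j, P.eval (xi x j) / Del j x = 0 := by
  have hdeg : P.degree < (Finset.univ : Finset (Fin m)).card :=
    hP.trans_le (by rw [Finset.card_fin]; exact_mod_cast m.sub_le 1)
  have h := Lagrange.coeff_eq_sum hx.injOn hdeg
  rw [Finset.card_fin, Polynomial.coeff_eq_zero_of_degree_lt hP] at h
  exact h.symm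

theorem sum_inv_xi_div_Del (hm : 0 < m) {x : Pt m} (hx : Function.Injective (xi x))
    (h0 : sigma m x ≠ 0) : ∑ j, (xi x j * Del j x)⁻¹ = (-1) ^ (m - 1) / sigma m x := by
  have h := congrFun (congrFun (sigmaInv_mul_sigmaMat hx) ⟨m - 1, by omega⟩) ⟨m - 1, by omega⟩
  have hterm (j : Fin m) : sigmaInv x ⟨m - 1, by omega⟩ j * sigmaMat x j ⟨m - 1, by omega⟩ =
      (-1) ^ (m - 1) * sigma m x * (xi x j * Del j x)⁻¹ := by
    have := xi_ne_zero h0 j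
    have := Del_ne_zero hx j
    simp only [sigmaInv, sigmaMat, Matrix.of_apply, ← xi_mul_sigmaHat_top j x, Nat.sub_self]
    field_simp
  rw [Matrix.mul_apply, Matrix.one_apply_eq, Finset.sum_congr rfl fun j _ => hterm j,
    ← Finset.mul_sum] at h
  have hs : ((-1 : ℝ) ^ (m - 1)) * (-1) ^ (m - 1) = 1 := by rw [← mul_pow]; simp
  rw [eq_div_iff h0]
  linear_combination (-1) ^ (m - 1) * h - (∑ j, (xi x j * Del j x)⁻¹) * sigma m x * hs

theorem sum_inv_xi_sq_div_Del (hm : 2 ≤ m) {x : Pt m} (hx : Function.Injective (xi x))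
    (h0 : sigma m x ≠ 0) :
    ∑ j, (xi x j ^ 2 * Del j x)⁻¹ = (-1) ^ (m - 1) * sigma (m - 1) x / sigma m x ^ 2 := by
  have h := congrFun (congrFun (sigmaInv_mul_sigmaMat hx) ⟨m - 1, by omega⟩) ⟨m - 2, by omega⟩
  have hterm (j : Fin m) : sigmaInv x ⟨m - 1, by omega⟩ j * sigmaMat x j ⟨m - 2, by omega⟩ =
      (-1) ^ (m - 1) * (sigma (m - 1) x * (xi x j * Del j x)⁻¹ -
        sigma m x * (xi x j ^ 2 * Del j x)⁻¹) := by
    have := xi_ne_zero h0 j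
    have := Del_ne_zero hx j
    have hσ := sigma_succ_eq (m - 2) j x
    rw [show m - 2 + 1 = m - 1 by omega] at hσ
    simp only [sigmaInv, sigmaMat, Matrix.of_apply, hσ, ← xi_mul_sigmaHat_top j x, Nat.sub_self]
    field_simp
    ring
  rw [Matrix.mul_apply, Matrix.one_apply_ne (by simp [Fin.ext_iff]; omega),
    Finset.sum_congr rfl fun j _ => hterm j, ← Finset.mul_sum, Finset.sum_sub_distrib,
    ← Finset.mul_sum, ← Finset.mul_sum, sum_inv_xi_div_Del (by omega) hx h0] at h
  have hsub := (mul_eq_zero.1 h).resolve_left (pow_ne_zero _ (by norm_num))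
  field_simp at hsub ⊢
  linear_combination -hsub

open Polynomial in
theorem sum_eval_div (hm : 2 ≤ m) {x : Pt m} (hx : Function.Injective (xi x)) (h0 : sigma m x ≠ 0)
    {R : ℝ[X]} (hR : R.natDegree ≤ m) :
    sigma m x ^ 2 * ∑ j, R.eval (xi x j) / (xi x j ^ 2 * Del j x) =
      -(-1) ^ m * (R.coeff 0 * sigma (m - 1) x + R.coeff 1 * sigma m x) := by
  have hQ : R.divX.divX.degree < (m - 1 : ℕ) :=
    degree_le_natDegree.trans_lt <| by
      simp only [natDegree_divX_eq_natDegree_tsub_one]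
      exact_mod_cast (by omega : R.natDegree - 1 - 1 < m - 1)
  have hterm (j : Fin m) : R.eval (xi x j) / (xi x j ^ 2 * Del j x) =
      R.coeff 0 * (xi x j ^ 2 * Del j x)⁻¹ + R.coeff 1 * (xi x j * Del j x)⁻¹ +
        R.divX.divX.eval (xi x j) / Del j x := by
    have hξ := xi_ne_zero h0 j
    have hΔ := Del_ne_zero hx j
    have heval : R.eval (xi x j) =
        (R.divX.divX.eval (xi x j) * xi x j + R.coeff 1) * xi x j + R.coeff 0 := by
      conv_lhs => rw [← divX_mul_X_add R, ← divX_mul_X_add R.divX]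
      simp
    rw [heval]
    field_simp
    ring
  simp only [hterm, Finset.sum_add_distrib, sum_eval_div_Del hx hQ, ← Finset.mul_sum, add_zero,
    sum_inv_xi_sq_div_Del hm hx h0, sum_inv_xi_div_Del (by omega) hx h0]
  obtain ⟨n, rfl⟩ : ∃ n, m = n + 1 := ⟨m - 1, by omega⟩
  simp only [Nat.add_one_sub_one, pow_succ]
  field_simp

theorem trace_sq_diagonal_sub_vecMulVec {n R : Type*} [Fintype n] [DecidableEq n] [CommRing R]
    {k : n} {a v w : n → R} (hv : v k = 0) (hw : w k = 0) :
    ((Matrix.diagonal a - Matrix.vecMulVec v (Pi.single k 1) -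
      Matrix.vecMulVec (Pi.single k 1) w) ^ 2).trace = ∑ j, a j ^ 2 + 2 * (v ⬝ᵥ w) := by
  have hdiag (u : n → R) : Matrix.diagonal a *ᵥ u = fun j => a j * u j :=
    funext (Matrix.mulVec_diagonal a u)
  have hdiag' (u : n → R) : u ᵥ* Matrix.diagonal a = fun j => u j * a j :=
    funext (Matrix.vecMul_diagonal u a)
  simp only [pow_two, sub_mul, mul_sub, Matrix.trace_sub, Matrix.diagonal_mul_diagonal,
    Matrix.trace_diagonal, Matrix.mul_vecMulVec, Matrix.vecMulVec_mul, hdiag, hdiag',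
    Matrix.vecMulVec_mulVec, Matrix.trace_vecMulVec]
  simp [hv, hw, dotProduct, Pi.single_apply, mul_comm (w _)]
  ring

/-- The coefficient `Δ_j / Θ_j(ξ_j)` of `dξ_j²`. -/
def baseCoeff (Θ : Fin m → ℝ → ℝ) (j : Fin m) (x : Pt m) : ℝ := Del j x / Θ j (xi x j)

/-- The coefficient `Θ_j(ξ_j) / Δ_j` of `θ_j²`. -/
def fibreCoeff (Θ : Fin m → ℝ → ℝ) (j : Fin m) (x : Pt m) : ℝ := Θ j (xi x j) / Del j x

/-- The matrix of the metric in the directions `∂/∂t_r`. -/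
def fibreMat (Θ : Fin m → ℝ → ℝ) (x : Pt m) : Matrix (Fin m) (Fin m) ℝ :=
  (sigmaMat x)ᵀ * Matrix.diagonal (fun j => fibreCoeff Θ j x) * sigmaMat x

/-- The logarithmic derivative of `Θ_j` at `ξ_j`. -/
def logDerivTheta (Θ : Fin m → ℝ → ℝ) (x : Pt m) (j : Fin m) : ℝ :=
  deriv (Θ j) (xi x j) / Θ j (xi x j)

/-- The logarithmic derivative of `Δ_j / Θ_j(ξ_j)` with respect to `ξ_k`. -/
def logDerivBase (Θ : Fin m → ℝ → ℝ) (x : Pt m) (j k : Fin m) : ℝ :=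
  (xi x k - xi x j)⁻¹ + if k = j then sumInv x j - logDerivTheta Θ x j else 0

/-- The matrix `C` with `∂θ_j/∂ξ_k = ∑_l C_{jl} θ_l`. -/
def frameDer (k : Fin m) (x : Pt m) : Matrix (Fin m) (Fin m) ℝ :=
  Matrix.diagonal (fun j => (xi x k - xi x j)⁻¹) -
    Matrix.vecMulVec (fun j => (xi x k - xi x j)⁻¹) (Pi.single k 1)

/-- The matrix of `G⁻¹ ∂G/∂ξ_k`, for `G = fibreMat Θ`, with respect to the coframe `θ_j`. -/
def frameLogPd (Θ : Fin m → ℝ → ℝ) (k : Fin m) (x : Pt m) : Matrix (Fin m) (Fin m) ℝ :=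
  Matrix.diagonal (fun j => 2 * (xi x k - xi x j)⁻¹ - logDerivBase Θ x j k) -
    Matrix.vecMulVec (fun j => (xi x k - xi x j)⁻¹) (Pi.single k 1) -
    Matrix.vecMulVec (Pi.single k 1)
      (fun l => baseCoeff Θ k x * fibreCoeff Θ l x * (xi x k - xi x l)⁻¹)

/-- The assumptions under which `metric Θ` is a (pseudo-Riemannian) orthotoric metric on `D`. -/
structure IsOrthotoric (Θ : Fin m → ℝ → ℝ) (D : Set (Pt m)) : Prop where
  isOpen : IsOpen D
  smooth : ∀ j, ContDiffOn ℝ ∞ (Θ j) ((fun x : Pt m => xi x j) '' D)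
  inj : ∀ x ∈ D, Function.Injective (xi x)
  ne_zero : ∀ x ∈ D, ∀ j, Θ j (xi x j) ≠ 0

variable {Θ : Fin m → ℝ → ℝ} {D : Set (Pt m)} {x : Pt m}

theorem inv_baseCoeff (Θ : Fin m → ℝ → ℝ) (j : Fin m) (x : Pt m) :
    (baseCoeff Θ j x)⁻¹ = fibreCoeff Θ j x := inv_div _ _

theorem fibreMat_apply (Θ : Fin m → ℝ → ℝ) (x : Pt m) (a b : Fin m) :
    fibreMat Θ x a b = ∑ j, sigmaHat a j x * fibreCoeff Θ j x * sigmaHat b j x := by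
  rw [fibreMat, Matrix.mul_apply]
  exact Finset.sum_congr rfl fun j _ => by
    rw [Matrix.mul_diagonal]
    simp only [sigmaMat, Matrix.transpose_apply, Matrix.of_apply]

theorem metric_eq_blockMetric (Θ : Fin m → ℝ → ℝ) :
    metric Θ = blockMetric (baseCoeff Θ) (fibreMat Θ) := by
  ext x a b
  rcases a with a | a <;> rcases b with b | b
  · by_cases hab : a = b <;> simp [metric, dxi, theta, baseCoeff, hab]
  · simp [metric, dxi, theta]
  · simp [metric, dxi, theta]
  · simp only [metric, dxi, theta, Matrix.of_apply, mul_zero, Finset.sum_const_zero, zero_add,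
      blockMetric_inr_inr, fibreMat_apply, fibreCoeff]
    exact Finset.sum_congr rfl fun j _ => by ring

theorem invariantAlong_sigma (r : ℕ) (a : Fin m) :
    InvariantAlong (Sum.inr a) (sigma r : Pt m → ℝ) := fun x s => by
  simp only [sigma, xi_add_inr]

theorem logDerivBase_self (x : Pt m) (k : Fin m) :
    logDerivBase Θ x k k = sumInv x k - logDerivTheta Θ x k := by
  simp [logDerivBase]

theorem sum_logDerivBase (x : Pt m) (k : Fin m) :
    ∑ j, logDerivBase Θ x j k = 2 * sumInv x k - logDerivTheta Θ x k := by
  simp only [logDerivBase, Finset.sum_add_distrib, Finset.sum_ite_eq, Finset.mem_univ, if_true]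
  rw [← sumInv]
  ring

namespace IsOrthotoric

theorem isOpen_image (h : IsOrthotoric Θ D) (j : Fin m) :
    IsOpen ((fun x : Pt m => xi x j) '' D) :=
  isOpenMap_eval (X := fun _ : Fin m ⊕ Fin m => ℝ) (Sum.inl j) D h.isOpen

theorem hasDerivAt_Theta (h : IsOrthotoric Θ D) {j : Fin m} {z : ℝ}
    (hz : z ∈ (fun x : Pt m => xi x j) '' D) : HasDerivAt (Θ j) (deriv (Θ j) z) z :=
  (differentiableAt_of_contDiffOn (h.isOpen_image j) (by simp) (h.smooth j) hz).hasDerivAt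

theorem hasDerivAt_deriv_Theta (h : IsOrthotoric Θ D) {j : Fin m} {z : ℝ}
    (hz : z ∈ (fun x : Pt m => xi x j) '' D) :
    HasDerivAt (deriv (Θ j)) (deriv (deriv (Θ j)) z) z :=
  (differentiableAt_of_contDiffOn (h.isOpen_image j) (n := ∞) (by simp)
    ((h.smooth j).deriv_of_isOpen (h.isOpen_image j) (by simp)) hz).hasDerivAt

theorem hasPd_Theta (h : IsOrthotoric Θ D) (hx : x ∈ D) (j k : Fin m) :
    HasPd (Sum.inl k) (fun y : Pt m => Θ j (xi y j))
      (deriv (Θ j) (xi x j) * if k = j then 1 else 0) x :=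
  HasDirDeriv.comp_deriv (h.hasDerivAt_Theta ⟨x, hx, rfl⟩) (hasPd_xi k j x)

theorem hasPd_deriv_Theta (h : IsOrthotoric Θ D) (hx : x ∈ D) (j k : Fin m) :
    HasPd (Sum.inl k) (fun y : Pt m => deriv (Θ j) (xi y j))
      (deriv (deriv (Θ j)) (xi x j) * if k = j then 1 else 0) x :=
  HasDirDeriv.comp_deriv (h.hasDerivAt_deriv_Theta ⟨x, hx, rfl⟩) (hasPd_xi k j x)

theorem contDiffOn_Theta (h : IsOrthotoric Θ D) (j : Fin m) :
    ContDiffOn ℝ ∞ (fun y : Pt m => Θ j (xi y j)) D :=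
  (h.smooth j).comp (contDiff_xi j).contDiffOn fun x hx => ⟨x, hx, rfl⟩

theorem baseCoeff_ne_zero (h : IsOrthotoric Θ D) (hx : x ∈ D) (j : Fin m) :
    baseCoeff Θ j x ≠ 0 := div_ne_zero (Del_ne_zero (h.inj x hx) j) (h.ne_zero x hx j)

theorem baseCoeff_mul_fibreCoeff (h : IsOrthotoric Θ D) (hx : x ∈ D) (j : Fin m) :
    baseCoeff Θ j x * fibreCoeff Θ j x = 1 := by
  rw [← inv_baseCoeff, mul_inv_cancel₀ (h.baseCoeff_ne_zero hx j)]

theorem contDiffOn_fibreCoeff (h : IsOrthotoric Θ D) (j : Fin m) :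
    ContDiffOn ℝ ∞ (fibreCoeff Θ j) D :=
  (h.contDiffOn_Theta j).div (contDiff_Del j).contDiffOn fun x hx => Del_ne_zero (h.inj x hx) j

theorem contDiffOn_fibreMat (h : IsOrthotoric Θ D) (a b : Fin m) :
    ContDiffOn ℝ ∞ (fun x => fibreMat Θ x a b) D := by
  simp only [fibreMat_apply]
  exact ContDiffOn.sum fun j _ => ((contDiff_sigmaHat a j).contDiffOn.mul
    (h.contDiffOn_fibreCoeff j)).mul (contDiff_sigmaHat b j).contDiffOn

theorem fibreMat_mul_eq_one (h : IsOrthotoric Θ D) (hx : x ∈ D) :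
    fibreMat Θ x *
      (sigmaInv x * Matrix.diagonal (fun j => baseCoeff Θ j x) * (sigmaInv x)ᵀ) = 1 := by
  have hS := sigmaMat_mul_sigmaInv (h.inj x hx)
  have hF : Matrix.diagonal (fun j => fibreCoeff Θ j x) *
      Matrix.diagonal (fun j => baseCoeff Θ j x) = 1 := by
    simp [Matrix.diagonal_mul_diagonal, mul_comm (fibreCoeff _ _ _), h.baseCoeff_mul_fibreCoeff hx]
  calc _ = (sigmaMat x)ᵀ * (Matrix.diagonal (fun j => fibreCoeff Θ j x) *
        ((sigmaMat x * sigmaInv x) * Matrix.diagonal (fun j => baseCoeff Θ j x))) *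
          (sigmaInv x)ᵀ := by simp only [fibreMat, Matrix.mul_assoc]
    _ = 1 := by
      rw [hS, Matrix.one_mul, hF, Matrix.mul_one, ← Matrix.transpose_mul,
        sigmaInv_mul_sigmaMat (h.inj x hx), Matrix.transpose_one]

theorem fibreMat_inv (h : IsOrthotoric Θ D) (hx : x ∈ D) : (fibreMat Θ x)⁻¹ =
    sigmaInv x * Matrix.diagonal (fun j => baseCoeff Θ j x) * (sigmaInv x)ᵀ :=
  Matrix.inv_eq_right_inv (h.fibreMat_mul_eq_one hx)

theorem isBlockMetric (h : IsOrthotoric Θ D) : IsBlockMetric (baseCoeff Θ) (fibreMat Θ) D where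
  isOpen := h.isOpen
  contDiffOn_base j := (contDiff_Del j).contDiffOn.div (h.contDiffOn_Theta j) fun x hx =>
    h.ne_zero x hx j
  contDiffOn_fibre := h.contDiffOn_fibreMat
  base_ne_zero _ hx := h.baseCoeff_ne_zero hx
  isUnit_det_fibre _ hx := Matrix.isUnit_det_of_right_inverse (h.fibreMat_mul_eq_one hx)
  isSymm_fibre x := by simp [Matrix.IsSymm, fibreMat, Matrix.transpose_mul, Matrix.mul_assoc]
  invariantAlong_base c j x s := by simp only [baseCoeff, Del, xi_add_inr]
  invariantAlong_fibre c x s := by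
    ext a b
    simp only [fibreMat_apply, fibreCoeff, Del, sigmaHat, xi_add_inr]

theorem hasPd_baseCoeff (h : IsOrthotoric Θ D) (hx : x ∈ D) (j k : Fin m) :
    HasPd (Sum.inl k) (baseCoeff Θ j) (baseCoeff Θ j x * logDerivBase Θ x j k) x := by
  have h0 := h.ne_zero x hx j
  have hval := (hasPd_Del (h.inj x hx) j k).mul ((h.hasPd_Theta hx j k).inv h0)
  convert! hval using 1
  simp only [baseCoeff, logDerivBase, logDerivTheta]
  by_cases hkj : k = j
  · simp only [hkj, if_true]
    field_simp
    ring
  · simp only [hkj, if_false]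
    field_simp
    ring

theorem hasPd_fibreCoeff (h : IsOrthotoric Θ D) (hx : x ∈ D) (j k : Fin m) :
    HasPd (Sum.inl k) (fibreCoeff Θ j) (-(fibreCoeff Θ j x * logDerivBase Θ x j k)) x := by
  have h0 := h.baseCoeff_ne_zero hx j
  rw [← funext (inv_baseCoeff Θ j)]
  convert (h.hasPd_baseCoeff hx j k).inv h0 using 1
  field_simp

theorem matrixPd_sigmaMat (hx : Function.Injective (xi x)) (k : Fin m) :
    matrixPd (Sum.inl k) sigmaMat x = frameDer k x * sigmaMat x := by
  ext j r
  rw [matrixPd, Matrix.of_apply, frameDer, Matrix.sub_mul, Matrix.sub_apply, Matrix.diagonal_mul,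
    Matrix.vecMulVec_mul, Matrix.vecMulVec_apply, Matrix.single_one_vecMul]
  exact (hasPd_sigmaHat hx r j k).pd_eq.trans (mul_sub _ _ _)

theorem matrixPd_diagonal_fibreCoeff (h : IsOrthotoric Θ D) (hx : x ∈ D) (k : Fin m) :
    matrixPd (Sum.inl k) (fun y => Matrix.diagonal fun j => fibreCoeff Θ j y) x =
      Matrix.diagonal fun j => -(fibreCoeff Θ j x * logDerivBase Θ x j k) := by
  ext a b
  by_cases hab : a = b
  · subst hab
    simpa [matrixPd] using! (h.hasPd_fibreCoeff hx a k).pd_eq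
  · simp [matrixPd, hab]

theorem frameDer_transpose_mul_add (h : IsOrthotoric Θ D) (hx : x ∈ D) (k : Fin m) :
    (frameDer k x)ᵀ * Matrix.diagonal (fun j => fibreCoeff Θ j x) +
      Matrix.diagonal (fun j => -(fibreCoeff Θ j x * logDerivBase Θ x j k)) +
      Matrix.diagonal (fun j => fibreCoeff Θ j x) * frameDer k x =
      Matrix.diagonal (fun j => fibreCoeff Θ j x) * frameLogPd Θ k x := by
  have hbf := h.baseCoeff_mul_fibreCoeff hx k
  ext a b
  simp only [frameDer, frameLogPd, Matrix.add_apply, Matrix.mul_diagonal, Matrix.diagonal_mul,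
    Matrix.transpose_apply, Matrix.sub_apply, Matrix.vecMulVec_apply, Matrix.diagonal_apply,
    Pi.single_apply]
  by_cases hak : a = k
  · subst hak
    by_cases hab : a = b
    · subst hab
      simp
    · simp only [hab, Ne.symm hab, if_true, if_false]
      linear_combination (fibreCoeff Θ b x * (xi x a - xi x b)⁻¹) * hbf
  · by_cases hab : a = b
    · subst hab
      simp only [hak, if_true, if_false]
      ring
    · simp only [hak, hab, Ne.symm hab, if_false]
      ring

theorem matrixPd_fibreMat (h : IsOrthotoric Θ D) (hx : x ∈ D) (k : Fin m) :
    matrixPd (Sum.inl k) (fibreMat Θ) x = (sigmaMat x)ᵀ *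
      (Matrix.diagonal (fun j => fibreCoeff Θ j x) * frameLogPd Θ k x) * sigmaMat x := by
  have hdiff {u : Pt m → ℝ} (hu : ContDiffOn ℝ ∞ u D) : DifferentiableAt ℝ u x :=
    differentiableAt_of_contDiffOn h.isOpen (by simp) hu hx
  have hS (a b : Fin m) : DifferentiableAt ℝ (fun y : Pt m => sigmaMat y a b) x :=
    hdiff (contDiff_sigmaHat b a).contDiffOn
  have hF (a b : Fin m) :
      DifferentiableAt ℝ (fun y => Matrix.diagonal (fun j => fibreCoeff Θ j y) a b) x := by
    by_cases hab : a = b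
    · simpa [hab] using! hdiff (h.contDiffOn_fibreCoeff b)
    · simp [hab]
  have hSF (a b : Fin m) : DifferentiableAt ℝ
      (fun y => ((sigmaMat y)ᵀ * Matrix.diagonal (fun j => fibreCoeff Θ j y)) a b) x := by
    simpa only [Matrix.mul_diagonal] using!
      (hS b a).mul (hdiff (h.contDiffOn_fibreCoeff b))
  have hSt : matrixPd (Sum.inl k) (fun y : Pt m => (sigmaMat y)ᵀ) x =
      (matrixPd (Sum.inl k) sigmaMat x)ᵀ := rfl
  have hG : fibreMat Θ = fun y => (sigmaMat y)ᵀ *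
      Matrix.diagonal (fun j => fibreCoeff Θ j y) * sigmaMat y := rfl
  rw [hG, matrixPd_mul hSF hS,
    matrixPd_mul (G := fun y : Pt m => (sigmaMat y)ᵀ) (fun a b => hS b a) hF, hSt,
    h.matrixPd_diagonal_fibreCoeff hx, matrixPd_sigmaMat (h.inj x hx),
    ← h.frameDer_transpose_mul_add hx]
  simp only [Matrix.transpose_mul, Matrix.mul_add, Matrix.add_mul, Matrix.mul_assoc]

theorem logPd_fibreMat (h : IsOrthotoric Θ D) (hx : x ∈ D) (k : Fin m) :
    logPd (Sum.inl k) (fibreMat Θ) x = sigmaInv x * frameLogPd Θ k x * sigmaMat x := by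
  have hS : (sigmaInv x)ᵀ * (sigmaMat x)ᵀ = 1 := by
    rw [← Matrix.transpose_mul, sigmaMat_mul_sigmaInv (h.inj x hx), Matrix.transpose_one]
  have hF : Matrix.diagonal (fun j => baseCoeff Θ j x) *
      Matrix.diagonal (fun j => fibreCoeff Θ j x) = 1 := by
    simp [Matrix.diagonal_mul_diagonal, h.baseCoeff_mul_fibreCoeff hx]
  calc _ = sigmaInv x * (Matrix.diagonal (fun j => baseCoeff Θ j x) *
        (((sigmaInv x)ᵀ * (sigmaMat x)ᵀ) *
          (Matrix.diagonal (fun j => fibreCoeff Θ j x) * frameLogPd Θ k x))) * sigmaMat x := by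
        simp only [logPd, h.fibreMat_inv hx, h.matrixPd_fibreMat hx, Matrix.mul_assoc]
    _ = _ := by rw [hS, Matrix.one_mul, ← Matrix.mul_assoc (Matrix.diagonal _), hF, Matrix.one_mul]

theorem trace_logPd (h : IsOrthotoric Θ D) (hx : x ∈ D) (k : Fin m) :
    (logPd (Sum.inl k) (fibreMat Θ) x).trace = logDerivTheta Θ x k := by
  rw [h.logPd_fibreMat hx, Matrix.trace_mul_cycle, sigmaMat_mul_sigmaInv (h.inj x hx),
    Matrix.one_mul, frameLogPd, Matrix.trace_sub, Matrix.trace_sub, Matrix.trace_diagonal,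
    Matrix.trace_vecMulVec, Matrix.trace_vecMulVec, dotProduct_single_one, single_one_dotProduct,
    Finset.sum_sub_distrib, ← Finset.mul_sum, ← sumInv, sum_logDerivBase]
  simp

theorem trace_logPd_sq (h : IsOrthotoric Θ D) (hx : x ∈ D) (k : Fin m) :
    (logPd (Sum.inl k) (fibreMat Θ) x ^ 2).trace =
      ∑ j, (2 * (xi x k - xi x j)⁻¹ - logDerivBase Θ x j k) ^ 2 +
      2 * ∑ j, baseCoeff Θ k x * fibreCoeff Θ j x * (xi x k - xi x j)⁻¹ ^ 2 := by
  have hS := sigmaMat_mul_sigmaInv (h.inj x hx)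
  have hsq : logPd (Sum.inl k) (fibreMat Θ) x ^ 2 =
      sigmaInv x * frameLogPd Θ k x ^ 2 * sigmaMat x := by
    calc _ = sigmaInv x * (frameLogPd Θ k x * ((sigmaMat x * sigmaInv x) * frameLogPd Θ k x)) *
          sigmaMat x := by simp only [pow_two, h.logPd_fibreMat hx, Matrix.mul_assoc]
      _ = _ := by rw [hS, Matrix.one_mul, pow_two]
  rw [hsq, Matrix.trace_mul_cycle, hS, Matrix.one_mul, frameLogPd,
    trace_sq_diagonal_sub_vecMulVec (by simp) (by simp)]
  simp only [dotProduct, pow_two, mul_assoc, mul_left_comm]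

end IsOrthotoric

theorem hasPd_inv_xi_sub (hx : Function.Injective (xi x)) (k j : Fin m) :
    HasPd (Sum.inl k) (fun y : Pt m => (xi y k - xi y j)⁻¹) (-(xi x k - xi x j)⁻¹ ^ 2) x := by
  by_cases hkj : k = j
  · simpa [hkj] using! HasDirDeriv.const (Pi.single (Sum.inl k) 1) 0 x
  · have h0 : xi x k - xi x j ≠ 0 := sub_ne_zero.2 fun h => hkj (hx h)
    convert! ((hasPd_xi k k x).sub (hasPd_xi k j x)).inv h0 using 1
    simp [hkj]

theorem hasPd_sumInv (hx : Function.Injective (xi x)) (k : Fin m) :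
    HasPd (Sum.inl k) (fun y : Pt m => sumInv y k) (-∑ j, (xi x k - xi x j)⁻¹ ^ 2) x := by
  rw [← Finset.sum_neg_distrib]
  exact HasDirDeriv.sum fun j _ => hasPd_inv_xi_sub hx k j

namespace IsOrthotoric

theorem hasPd_logDerivTheta (h : IsOrthotoric Θ D) (hx : x ∈ D) (k : Fin m) :
    HasPd (Sum.inl k) (fun y => logDerivTheta Θ y k)
      (deriv (deriv (Θ k)) (xi x k) / Θ k (xi x k) - logDerivTheta Θ x k ^ 2) x := by
  have h0 := h.ne_zero x hx k
  convert! (h.hasPd_deriv_Theta hx k k).mul ((h.hasPd_Theta hx k k).inv h0) using 1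
  simp only [if_true, logDerivTheta]
  field_simp
  ring

theorem fibreCoeff_mul_logDerivTheta (h : IsOrthotoric Θ D) (hx : x ∈ D) (k : Fin m) :
    fibreCoeff Θ k x * logDerivTheta Θ x k = deriv (Θ k) (xi x k) / Del k x := by
  have h0 := h.ne_zero x hx k
  rw [fibreCoeff, logDerivTheta]
  field_simp

theorem hasPd_deriv_Theta_div_Del (h : IsOrthotoric Θ D) (hx : x ∈ D) (k : Fin m) :
    HasPd (Sum.inl k) (fun y => deriv (Θ k) (xi y k) / Del k y)
      ((deriv (deriv (Θ k)) (xi x k) - deriv (Θ k) (xi x k) * sumInv x k) / Del k x) x := by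
  have h0 := Del_ne_zero (h.inj x hx) k
  convert! (h.hasPd_deriv_Theta hx k k).mul ((hasPd_Del (h.inj x hx) k k).inv h0) using 1
  simp only [if_true, sub_self, inv_zero]
  field_simp
  ring

theorem christoffelTrace_inl (h : IsOrthotoric Θ D) (hx : x ∈ D) (k : Fin m) :
    christoffelTrace (blockMetric (baseCoeff Θ) (fibreMat Θ)) (Sum.inl k) x = sumInv x k := by
  rw [h.isBlockMetric.christoffelTrace_inl hx, h.trace_logPd hx]
  simp only [(h.hasPd_baseCoeff hx _ k).pd_eq, inv_mul_cancel_left₀ (h.baseCoeff_ne_zero hx _),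
    sum_logDerivBase]
  ring

theorem christoffel_inl (h : IsOrthotoric Θ D) (hx : x ∈ D) (i : Fin m) :
    (Matrix.of fun k n => christoffel (blockMetric (baseCoeff Θ) (fibreMat Θ))
      (Sum.inl k) (Sum.inl i) (Sum.inl n) x) =
    (1 / 2 : ℝ) • (Matrix.diagonal (fun n => logDerivBase Θ x n i) -
      Matrix.vecMulVec (fun k => fibreCoeff Θ k x * baseCoeff Θ i x * (xi x k - xi x i)⁻¹)
        (Pi.single i 1) -
      Matrix.vecMulVec (Pi.single i 1) (fun n => (xi x i - xi x n)⁻¹)) := by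
  have hfb (k : Fin m) : fibreCoeff Θ k x * baseCoeff Θ k x = 1 := by
    rw [mul_comm, h.baseCoeff_mul_fibreCoeff hx]
  ext k n
  simp only [Matrix.of_apply, h.isBlockMetric.christoffel_inl_inl_inl hx, inv_baseCoeff,
    (h.hasPd_baseCoeff hx _ _).pd_eq, Matrix.smul_apply, Matrix.sub_apply, Matrix.diagonal_apply,
    Matrix.vecMulVec_apply, Pi.single_apply, smul_eq_mul, mul_add, mul_sub, mul_ite, mul_zero,
    ← mul_assoc (fibreCoeff _ _ _)]
  by_cases hnk : n = k
  · subst hnk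
    by_cases hni : n = i
    · subst hni
      simp [hfb]
    · simp [hni, Ne.symm hni, hfb]
  · by_cases hik : i = k
    · subst hik
      simp only [hnk, Ne.symm hnk, logDerivBase, if_true, if_false]
      rw [← neg_sub (xi x i), inv_neg, hfb]
      ring
    · by_cases hin : i = n
      · subst hin
        simp only [hnk, Ne.symm hnk, logDerivBase, if_true, if_false]
        ring
      · simp [hnk, hik, hin, Ne.symm hnk, Ne.symm hik, Ne.symm hin]

theorem sum_christoffel_mul_christoffel (h : IsOrthotoric Θ D) (hx : x ∈ D) (i : Fin m) :
    ∑ k, ∑ n, christoffel (blockMetric (baseCoeff Θ) (fibreMat Θ)) (Sum.inl k) (Sum.inl i)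
        (Sum.inl n) x *
      christoffel (blockMetric (baseCoeff Θ) (fibreMat Θ)) (Sum.inl n) (Sum.inl k) (Sum.inl i) x +
      1 / 4 * (logPd (Sum.inl i) (fibreMat Θ) x ^ 2).trace =
    1 / 2 * (∑ j, (xi x i - xi x j)⁻¹ ^ 2 + (sumInv x i - logDerivTheta Θ x i) ^ 2) := by
  have hflip (j : Fin m) : (xi x j - xi x i)⁻¹ = -(xi x i - xi x j)⁻¹ := by
    rw [← neg_sub, inv_neg]
  have hdiag (j : Fin m) : logDerivBase Θ x j i ^ 2 +
      (2 * (xi x i - xi x j)⁻¹ - logDerivBase Θ x j i) ^ 2 =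
      2 * ((xi x i - xi x j)⁻¹ ^ 2 +
        if i = j then (sumInv x i - logDerivTheta Θ x i) ^ 2 else 0) := by
    rw [logDerivBase]
    by_cases hij : i = j
    · simp only [hij, if_true, sub_self, inv_zero]
      ring
    · simp only [hij, if_false]
      ring
  have htrace : ∑ k, ∑ n, christoffel (blockMetric (baseCoeff Θ) (fibreMat Θ)) (Sum.inl k)
      (Sum.inl i) (Sum.inl n) x *
      christoffel (blockMetric (baseCoeff Θ) (fibreMat Θ)) (Sum.inl n) (Sum.inl k) (Sum.inl i) x =
      ((Matrix.of fun k n => christoffel (blockMetric (baseCoeff Θ) (fibreMat Θ))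
        (Sum.inl k) (Sum.inl i) (Sum.inl n) x) ^ 2).trace := by
    simp only [h.isBlockMetric.christoffel_inl_inl_inl_comm hx _ _ i, sq, Matrix.trace,
      Matrix.diag_apply, Matrix.mul_apply, Matrix.of_apply]
  have hsum := Finset.sum_congr rfl fun j (_ : j ∈ Finset.univ) => hdiag j
  simp only [Finset.sum_add_distrib, ← Finset.mul_sum, Finset.sum_ite_eq, Finset.mem_univ,
    if_true] at hsum
  rw [htrace, h.christoffel_inl hx, smul_pow, Matrix.trace_smul,
    trace_sq_diagonal_sub_vecMulVec (by simp) (by simp), h.trace_logPd_sq hx]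
  have hcross : (fun k => fibreCoeff Θ k x * baseCoeff Θ i x * (xi x k - xi x i)⁻¹) ⬝ᵥ
      (fun n => (xi x i - xi x n)⁻¹) =
      -∑ j, baseCoeff Θ i x * fibreCoeff Θ j x * (xi x i - xi x j)⁻¹ ^ 2 := by
    rw [dotProduct, ← Finset.sum_neg_distrib]
    exact Finset.sum_congr rfl fun j _ => by rw [hflip]; ring
  rw [hcross, smul_eq_mul]
  linear_combination 1 / 4 * hsum

theorem christoffel_inl_inl_inl_self (h : IsOrthotoric Θ D) (hx : x ∈ D) (k i : Fin m) :
    christoffel (blockMetric (baseCoeff Θ) (fibreMat Θ)) (Sum.inl k) (Sum.inl i) (Sum.inl i) x =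
      -(1 / 2) * (fibreCoeff Θ k x * baseCoeff Θ i x * (xi x k - xi x i)⁻¹) +
        if k = i then 1 / 2 * (sumInv x i - logDerivTheta Θ x i) else 0 := by
  have hentry := congrFun₂ (h.christoffel_inl hx i) k i
  by_cases hki : k = i
  · subst hki
    simpa [logDerivBase_self, Matrix.vecMulVec_apply] using hentry
  · simpa [hki, Matrix.vecMulVec_apply] using hentry

theorem pd_christoffel_inl_inl_inl_self (h : IsOrthotoric Θ D) (hx : x ∈ D) (k i : Fin m) :
    pd (Sum.inl k) (christoffel (blockMetric (baseCoeff Θ) (fibreMat Θ))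
      (Sum.inl k) (Sum.inl i) (Sum.inl i)) x =
      -(1 / 2) * (fibreCoeff Θ k x * baseCoeff Θ i x * (xi x k - xi x i)⁻¹) *
        (logDerivTheta Θ x k - sumInv x k) +
      if k = i then 1 / 2 * (-(∑ j, (xi x i - xi x j)⁻¹ ^ 2) -
        (deriv (deriv (Θ i)) (xi x i) / Θ i (xi x i) - logDerivTheta Θ x i ^ 2)) else 0 := by
  rw [pd_congr_of_eqOn h.isOpen hx fun y hy => h.christoffel_inl_inl_inl_self hy k i]
  have hoff := (((h.hasPd_fibreCoeff hx k k).mul (h.hasPd_baseCoeff hx i k)).mul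
    (hasPd_inv_xi_sub (h.inj x hx) k i)).const_mul (-(1 / 2))
  rw [logDerivBase_self] at hoff
  by_cases hki : k = i
  · subst hki
    simp only [if_true]
    refine (hoff.add (((hasPd_sumInv (h.inj x hx) k).sub
      (h.hasPd_logDerivTheta hx k)).const_mul (1 / 2))).pd_eq.trans ?_
    simp
  · simp only [hki, if_false, add_zero]
    refine hoff.pd_eq.trans ?_
    simp only [logDerivBase, hki, if_false]
    ring

theorem sum_pd_christoffel_add_sum_christoffel (h : IsOrthotoric Θ D) (hx : x ∈ D) (i : Fin m) :
    ∑ k, pd (Sum.inl k) (christoffel (blockMetric (baseCoeff Θ) (fibreMat Θ))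
        (Sum.inl k) (Sum.inl i) (Sum.inl i)) x +
      ∑ k, sumInv x k * christoffel (blockMetric (baseCoeff Θ) (fibreMat Θ))
        (Sum.inl k) (Sum.inl i) (Sum.inl i) x =
    -(1 / 2) * (baseCoeff Θ i x *
        ∑ k, fibreCoeff Θ k x * logDerivTheta Θ x k * (xi x k - xi x i)⁻¹) +
      1 / 2 * (-(∑ j, (xi x i - xi x j)⁻¹ ^ 2) -
        (deriv (deriv (Θ i)) (xi x i) / Θ i (xi x i) - logDerivTheta Θ x i ^ 2)) +
      sumInv x i * (1 / 2 * (sumInv x i - logDerivTheta Θ x i)) := by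
  have hterm (k : Fin m) : pd (Sum.inl k) (christoffel (blockMetric (baseCoeff Θ) (fibreMat Θ))
        (Sum.inl k) (Sum.inl i) (Sum.inl i)) x +
      sumInv x k * christoffel (blockMetric (baseCoeff Θ) (fibreMat Θ))
        (Sum.inl k) (Sum.inl i) (Sum.inl i) x =
      -(1 / 2) * (baseCoeff Θ i x *
        (fibreCoeff Θ k x * logDerivTheta Θ x k * (xi x k - xi x i)⁻¹)) +
      if k = i then 1 / 2 * (-(∑ j, (xi x i - xi x j)⁻¹ ^ 2) -
          (deriv (deriv (Θ i)) (xi x i) / Θ i (xi x i) - logDerivTheta Θ x i ^ 2)) +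
        sumInv x i * (1 / 2 * (sumInv x i - logDerivTheta Θ x i)) else 0 := by
    rw [h.pd_christoffel_inl_inl_inl_self hx, h.christoffel_inl_inl_inl_self hx]
    by_cases hki : k = i
    · subst hki
      simp only [if_true]
      ring
    · simp only [hki, if_false]
      ring
  simp only [← Finset.sum_add_distrib, hterm]
  simp only [Finset.sum_add_distrib, Finset.sum_ite_eq', Finset.mem_univ, if_true,
    ← Finset.mul_sum, add_assoc]

theorem inv_mul_ricci_inl_inl (h : IsOrthotoric Θ D) (hx : x ∈ D) (i : Fin m) :
    (baseCoeff Θ i x)⁻¹ * ricci (blockMetric (baseCoeff Θ) (fibreMat Θ)) (Sum.inl i) (Sum.inl i) x =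
      -(1 / 2) * (deriv (deriv (Θ i)) (xi x i) / Del i x) +
      1 / 2 * (deriv (Θ i) (xi x i) / Del i x * sumInv x i) -
      1 / 2 * ∑ k, deriv (Θ k) (xi x k) / Del k x * (xi x k - xi x i)⁻¹ := by
  have hS : pd (Sum.inl i) (christoffelTrace (blockMetric (baseCoeff Θ) (fibreMat Θ)) (Sum.inl i))
      x = -∑ j, (xi x i - xi x j)⁻¹ ^ 2 := by
    rw [pd_congr_of_eqOn h.isOpen hx fun y hy => h.christoffelTrace_inl hy i]
    exact (hasPd_sumInv (h.inj x hx) i).pd_eq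
  have hfb := h.baseCoeff_mul_fibreCoeff hx i
  have hΘ : fibreCoeff Θ i x * (deriv (deriv (Θ i)) (xi x i) / Θ i (xi x i)) =
      deriv (deriv (Θ i)) (xi x i) / Del i x := by
    have h0 := h.ne_zero x hx i
    rw [fibreCoeff]
    field_simp
  simp only [← h.fibreCoeff_mul_logDerivTheta hx]
  rw [h.isBlockMetric.ricci_inl_inl hx, hS, inv_baseCoeff]
  simp only [h.christoffelTrace_inl hx]
  linear_combination fibreCoeff Θ i x * h.sum_pd_christoffel_add_sum_christoffel hx i -
    fibreCoeff Θ i x * h.sum_christoffel_mul_christoffel hx i - 1 / 2 * hΘ -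
    1 / 2 * (∑ k, fibreCoeff Θ k x * logDerivTheta Θ x k * (xi x k - xi x i)⁻¹) * hfb

theorem sum_inv_mul_ricci_inr_inr (h : IsOrthotoric Θ D) (hx : x ∈ D) :
    ∑ a, ∑ b, (fibreMat Θ x)⁻¹ a b *
      ricci (blockMetric (baseCoeff Θ) (fibreMat Θ)) (Sum.inr a) (Sum.inr b) x =
      -(1 / 2) * ∑ k, deriv (deriv (Θ k)) (xi x k) / Del k x := by
  have htr (k : Fin m) {y : Pt m} (hy : y ∈ D) :
      (baseCoeff Θ k y)⁻¹ * (logPd (Sum.inl k) (fibreMat Θ) y).trace =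
        deriv (Θ k) (xi y k) / Del k y := by
    rw [h.trace_logPd hy, inv_baseCoeff, h.fibreCoeff_mul_logDerivTheta hy]
  rw [h.isBlockMetric.sum_inv_mul_ricci_inr_inr hx]
  congr! 2 with k
  rw [pd_congr_of_eqOn h.isOpen hx fun y hy => htr k hy, (h.hasPd_deriv_Theta_div_Del hx k).pd_eq,
    htr k hx, h.christoffelTrace_inl hx]
  ring

theorem scalarCurvature_eq (h : IsOrthotoric Θ D) (hx : x ∈ D) :
    scalarCurvature (metric Θ) x = -∑ j, deriv (deriv (Θ j)) (xi x j) / Del j x := by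
  have hcancel : ∑ i, ∑ k, deriv (Θ k) (xi x k) / Del k x * (xi x k - xi x i)⁻¹ =
      ∑ k, deriv (Θ k) (xi x k) / Del k x * sumInv x k := by
    rw [Finset.sum_comm]
    simp only [sumInv, Finset.mul_sum]
  rw [metric_eq_blockMetric, h.isBlockMetric.scalarCurvature_eq hx, h.sum_inv_mul_ricci_inr_inr hx]
  simp only [h.inv_mul_ricci_inl_inl hx, Finset.sum_add_distrib, Finset.sum_sub_distrib,
    ← Finset.mul_sum, hcancel]
  ring

theorem normSqDiff_eq (h : IsOrthotoric Θ D) (hx : x ∈ D) {u : Pt m → ℝ}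
    (hu : ∀ a : Fin m, InvariantAlong (Sum.inr a) u) :
    normSqDiff (metric Θ) u x = ∑ j, Θ j (xi x j) / Del j x * pd (Sum.inl j) u x ^ 2 := by
  rw [metric_eq_blockMetric, h.isBlockMetric.normSqDiff_eq hx hu]
  simp only [inv_baseCoeff, fibreCoeff]

theorem laplacian_eq (h : IsOrthotoric Θ D) (hx : x ∈ D) {u : Pt m → ℝ}
    (hu : ∀ a : Fin m, InvariantAlong (Sum.inr a) u) :
    laplacian (metric Θ) u x = -∑ j, (Θ j (xi x j) / Del j x * pd (Sum.inl j) (pd (Sum.inl j) u) x +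
      deriv (Θ j) (xi x j) / Del j x * pd (Sum.inl j) u x) := by
  rw [metric_eq_blockMetric, h.isBlockMetric.laplacian_eq hx hu]
  congr! 4 with j
  · rw [inv_baseCoeff, fibreCoeff]
  · rw [h.christoffelTrace_inl hx, ← h.fibreCoeff_mul_logDerivTheta hx]
    simp only [inv_baseCoeff, (h.hasPd_fibreCoeff hx j j).pd_eq, logDerivBase_self]
    ring

end IsOrthotoric

/-- The Euler operator `z² φ'' - 2 (p - 1) z φ' + p (p - 1) φ`, which on either half-line has
kernel spanned by `|z| ^ (p - 1)` and `|z| ^ p`. -/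
def eulerOp (p : ℝ) (φ : ℝ → ℝ) (z : ℝ) : ℝ :=
  z ^ 2 * deriv (deriv φ) z - 2 * (p - 1) * z * deriv φ z + p * (p - 1) * φ z

theorem IsOrthotoric.weightedScal_eq (h : IsOrthotoric Θ D) (p : ℝ) (hx : x ∈ D)
    (h0 : sigma m x ≠ 0) :
    weightedScal (metric Θ) (sigma m) p x =
      -sigma m x ^ 2 * ∑ j, eulerOp p (Θ j) (xi x j) / (xi x j ^ 2 * Del j x) := by
  have hpd (j : Fin m) : pd (Sum.inl j) (sigma m) = (sigmaHat (m - 1) j : Pt m → ℝ) :=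
    funext fun y => (hasPd_sigma_top j y).pd_eq
  have hpd_pd (j : Fin m) : pd (Sum.inl j) (sigmaHat (m - 1) j) x = 0 :=
    (hasPd_esymm_of_notMem (Finset.notMem_erase j Finset.univ) (m - 1) x).pd_eq
  have hsigmaHat (j : Fin m) : sigmaHat (m - 1) j x = sigma m x / xi x j := by
    rw [← xi_mul_sigmaHat_top j, mul_div_cancel_left₀ _ (xi_ne_zero h0 j)]
  rw [weightedScal, h.scalarCurvature_eq hx, h.laplacian_eq hx (invariantAlong_sigma m),
    h.normSqDiff_eq hx (invariantAlong_sigma m)]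
  simp only [hpd, hpd_pd, hsigmaHat, mul_neg, neg_mul, Finset.mul_sum, sub_neg_eq_add,
    ← Finset.sum_neg_distrib, ← Finset.sum_sub_distrib]
  refine Finset.sum_congr rfl fun j _ => ?_
  have hξ := xi_ne_zero h0 j
  have hΔ := Del_ne_zero (h.inj x hx) j
  rw [eulerOp]
  field_simp
  ring

theorem invariantAlong_metric (Θ : Fin m → ℝ → ℝ) (a : Fin m) :
    InvariantAlong (Sum.inr a) (metric Θ) := fun x s => by
  have htheta (j : Fin m) : theta j (x + s • Pi.single (Sum.inr a) 1) = theta j x := by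
    ext (_ | _) <;> simp only [theta, sigmaHat, xi_add_inr]
  simp only [metric, Del, xi_add_inr, htheta]

theorem pd_inr_metric (Θ : Fin m → ℝ → ℝ) (a : Fin m) (i j : Fin m ⊕ Fin m) (x : Pt m) :
    pd (Sum.inr a) (fun y => metric Θ y i j) x = 0 :=
  InvariantAlong.pd_eq_zero (fun y s => by simp only [invariantAlong_metric Θ a y s]) x

theorem sum_mul_kahlerForm_inl (v : Fin m ⊕ Fin m → ℝ) (x : Pt m) (j : Fin m) :
    ∑ i, v i * kahlerForm x i (Sum.inl j) = -∑ r : Fin m, v (Sum.inr r) * sigmaHat r j x := by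
  simp [Fintype.sum_sum_type, kahlerForm, dxi, theta]

theorem sum_mul_kahlerForm_inr (v : Fin m ⊕ Fin m → ℝ) (x : Pt m) (r : Fin m) :
    ∑ i, v i * kahlerForm x i (Sum.inr r) = ∑ i, v (Sum.inl i) * sigmaHat r i x := by
  simp [Fintype.sum_sum_type, kahlerForm, dxi, theta]

theorem hasPd_sum_sigma (b : Fin m → ℝ) (j : Fin m) (x : Pt m) :
    HasPd (Sum.inl j) (fun y : Pt m => ∑ r : Fin m, b r * sigma (r + 1) y)
      (∑ r : Fin m, b r * sigmaHat r j x) x :=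
  HasDirDeriv.sum fun r _ => (hasPd_sigma r j x).const_mul (b r)

theorem contDiff_sum_sigma (b : Fin m → ℝ) :
    ContDiff ℝ ∞ (fun y : Pt m => ∑ r : Fin m, b r * sigma (r + 1) y) :=
  ContDiff.sum fun _ _ => contDiff_const.mul (contDiff_sigma _)

theorem invariantAlong_sum_sigma (b : Fin m → ℝ) (a : Fin m) :
    InvariantAlong (Sum.inr a) (fun y : Pt m => ∑ r : Fin m, b r * sigma (r + 1) y) :=
  fun y s => by simp only [invariantAlong_sigma _ a y s]

theorem isKillingPotential_of_eq_sum (hD : IsOpen D) {u : Pt m → ℝ} {c : ℝ} {b : Fin m → ℝ}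
    (hu : ∀ x ∈ D, u x = c + ∑ r : Fin m, b r * sigma (r + 1) x) :
    IsKillingPotential (metric Θ) kahlerForm D u := by
  refine ⟨(contDiff_const.add (contDiff_sum_sigma b)).contDiffOn.congr hu,
    Sum.elim (fun _ _ => 0) (fun r _ => b r), ⟨?_, fun x _ i j => ?_⟩, fun x hx => ?_⟩
  · rintro (_ | _) <;> exact contDiffOn_const
  · simp [Fintype.sum_sum_type, pd_inr_metric]
  · have hpd (j : Fin m ⊕ Fin m) :
        pd j u x = pd j (fun y => ∑ r : Fin m, b r * sigma (r + 1) y) x :=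
      (pd_congr_of_eqOn hD hx hu).trans <| by
        rw [((HasDirDeriv.const _ c x).add (hasPd_pd
          ((contDiff_sum_sigma b).contDiffAt.differentiableAt (by simp)) j)).pd_eq, zero_add]
    rintro (j | j)
    · rw [sum_mul_kahlerForm_inl, hpd, (hasPd_sum_sigma b j x).pd_eq]
      rfl
    · rw [sum_mul_kahlerForm_inr, hpd, (invariantAlong_sum_sigma b j).pd_eq_zero]
      simp

section KillingPotential

variable {u : Pt m → ℝ} {X : Fin m ⊕ Fin m → Pt m → ℝ}

namespace IsOrthotoric

theorem pd_inl_killingField (h : IsOrthotoric Θ D) (hX : IsKillingField (metric Θ) D X)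
    (hbase : ∀ x ∈ D, ∀ i, X (Sum.inl i) x = 0) (hx : x ∈ D) (i r : Fin m) :
    pd (Sum.inl i) (X (Sum.inr r)) x = 0 := by
  suffices (fun r => pd (Sum.inl i) (X (Sum.inr r)) x) ᵥ* fibreMat Θ x = 0 from
    congrFun (Matrix.eq_zero_of_vecMul_eq_zero (h.isBlockMetric.isUnit_det_fibre x hx).ne_zero
      this) r
  ext s
  have hpd (k : Fin m) (l : Fin m ⊕ Fin m) : pd l (X (Sum.inl k)) x = 0 := by
    rw [pd_congr_of_eqOn h.isOpen hx fun y hy => hbase y hy k, pd_const]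
  have hLie := hX.2 x hx (Sum.inl i) (Sum.inr s)
  simp only [Fintype.sum_sum_type, hpd, hbase x hx, pd_inr_metric, zero_mul, mul_zero, zero_add,
    Finset.sum_const_zero] at hLie
  simpa [metric_eq_blockMetric, Matrix.vecMul, dotProduct, mul_comm] using hLie

/-- Differentiating `∂u/∂ξ_j = ∑ r, X_r σ_r(ξ̂_j)` along `t_a` gives a nonsingular linear system for
the `∂X_r/∂t_a`. -/
theorem pd_inr_hamiltonian (h : IsOrthotoric Θ D)
    (hsmooth : ∀ r : Fin m, DifferentiableOn ℝ (X (Sum.inr r)) D)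
    (hinv : ∀ a : Fin m, InvariantAlong (Sum.inr a) u)
    (hpd : ∀ x ∈ D, ∀ j, pd (Sum.inl j) u x = ∑ r : Fin m, X (Sum.inr r) x * sigmaHat r j x)
    (hx : x ∈ D) (a r : Fin m) : pd (Sum.inr a) (X (Sum.inr r)) x = 0 := by
  refine eq_zero_of_sum_sigmaHat (h.inj x hx) (c := fun r => pd (Sum.inr a) (X (Sum.inr r)) x)
    (fun j => ?_) r
  have hsigmaHat (r : Fin m) : HasPd (Sum.inr a) (sigmaHat r j : Pt m → ℝ) 0 x := by
    convert! hasPd_pd ((contDiff_sigmaHat r j).contDiffAt.differentiableAt (by simp)) (Sum.inr a)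
    exact (InvariantAlong.pd_eq_zero (fun y s => by simp only [sigmaHat, xi_add_inr]) x).symm
  have hsum := HasDirDeriv.sum (s := Finset.univ) fun r (_ : r ∈ Finset.univ) =>
    (hasPd_pd ((hsmooth r).differentiableAt (h.isOpen.mem_nhds hx)) (Sum.inr a)).mul (hsigmaHat r)
  rw [← ((hinv a).pd (Sum.inl j)).pd_eq_zero x, pd_congr_of_eqOn h.isOpen hx fun y hy => hpd y hy j,
    hsum.pd_eq]
  simp

theorem eq_sum_of_isKillingPotential (h : IsOrthotoric Θ D) (hDc : IsPreconnected D)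
    (hinv : ∀ a : Fin m, InvariantAlong (Sum.inr a) u)
    (hu : IsKillingPotential (metric Θ) kahlerForm D u) :
    ∃ (c : ℝ) (b : Fin m → ℝ), ∀ x ∈ D, u x = c + ∑ r : Fin m, b r * sigma (r + 1) x := by
  obtain ⟨hsmooth, X, hX, hXu⟩ := hu
  have hXdiff (k) : DifferentiableOn ℝ (X k) D := (hX.1 k).differentiableOn (by simp)
  have hbase (x) (hx : x ∈ D) (i : Fin m) : X (Sum.inl i) x = 0 := by
    have hdet := (Matrix.isUnit_det_of_right_inverse (sigmaMat_mul_sigmaInv (h.inj x hx))).ne_zero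
    refine congrFun (Matrix.eq_zero_of_vecMul_eq_zero (v := fun i => X (Sum.inl i) x) hdet
      (funext fun r => ?_)) i
    change ∑ i, X (Sum.inl i) x * sigmaHat r i x = 0
    rw [← sum_mul_kahlerForm_inr fun i => X i x, hXu x hx, (hinv r).pd_eq_zero, neg_zero]
  have hpd (x) (hx : x ∈ D) (j : Fin m) :
      pd (Sum.inl j) u x = ∑ r : Fin m, X (Sum.inr r) x * sigmaHat r j x := by
    rw [← neg_inj, ← hXu x hx, sum_mul_kahlerForm_inl fun i => X i x]
  have hconst (r : Fin m) : ∃ b, ∀ x ∈ D, X (Sum.inr r) x = b := by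
    refine exists_const_of_pd_eq_zero h.isOpen hDc (hXdiff _) fun x hx => ?_
    rintro (i | a)
    · exact h.pd_inl_killingField hX hbase hx i r
    · exact h.pd_inr_hamiltonian (fun r => hXdiff _) hinv hpd hx a r
  choose b hb using hconst
  have hud := hsmooth.differentiableOn (by simp)
  obtain ⟨c, hc⟩ := exists_const_of_pd_eq_zero h.isOpen hDc (hud.fun_sub
      ((contDiff_sum_sigma b).differentiable (by simp)).differentiableOn) fun x hx => by
    rintro (j | a)
    · rw [((hasPd_pd (hud.differentiableAt (h.isOpen.mem_nhds hx)) _).sub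
        (hasPd_sum_sigma b j x)).pd_eq, hpd x hx]
      simp [hb _ x hx]
    · exact InvariantAlong.pd_eq_zero (fun y s => by
        simp only [hinv a y s, invariantAlong_sum_sigma b a y s]) x
  exact ⟨c, b, fun x hx => eq_add_of_sub_eq (hc x hx)⟩

end IsOrthotoric

end KillingPotential

end Orthotoric

section CauchyEuler

variable {I : Set ℝ} {φ φ₁ φ₂ : ℝ → ℝ} {q s : ℝ}

theorem hasDerivAt_abs_rpow_of_ne_zero (q : ℝ) {z : ℝ} (hz : z ≠ 0) :
    HasDerivAt (fun z => |z| ^ q) (q * z⁻¹ * |z| ^ q) z := by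
  have h := (hasDerivAt_abs hz).rpow_const (p := q) (Or.inl (abs_ne_zero.2 hz))
  refine h.congr_deriv ?_
  rw [Real.rpow_sub_one (abs_ne_zero.2 hz)]
  rcases lt_or_gt_of_ne hz with h0 | h0
  · rw [abs_of_neg h0, sign_neg h0, SignType.coe_neg_one]
    field_simp
  · rw [abs_of_pos h0, sign_pos h0, SignType.coe_one]
    field_simp

theorem exists_const_of_cauchyEuler (hI : IsOpen I) (hIc : IsPreconnected I) (h0 : (0 : ℝ) ∉ I)
    (h₁ : ∀ z ∈ I, HasDerivAt φ (φ₁ z) z) (h₂ : ∀ z ∈ I, HasDerivAt φ₁ (φ₂ z) z)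
    (hode : ∀ z ∈ I, z ^ 2 * φ₂ z = (q + s - 1) * z * φ₁ z - q * s * φ z) :
    ∃ c, ∀ z ∈ I, z * φ₁ z - q * φ z = c * |z| ^ s := by
  have hderiv (z) (hz : z ∈ I) :
      HasDerivAt (fun z => (z * φ₁ z - q * φ z) * |z| ^ (-s)) 0 z := by
    have hz0 : z ≠ 0 := ne_of_mem_of_not_mem hz h0
    refine ((((hasDerivAt_id z).mul (h₂ z hz)).sub ((h₁ z hz).const_mul q)).mul
      (hasDerivAt_abs_rpow_of_ne_zero (-s) hz0)).congr_deriv ?_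
    simp only [id_eq, Pi.sub_apply, Pi.mul_apply]
    field_simp
    linear_combination |z| ^ (-s) * hode z hz
  obtain ⟨c, hc⟩ := hI.exists_is_const_of_deriv_eq_zero hIc
    (fun z hz => (hderiv z hz).differentiableAt.differentiableWithinAt)
    fun z hz => (hderiv z hz).deriv
  refine ⟨c, fun z hz => ?_⟩
  have hz0 : 0 < |z| := abs_pos.2 (ne_of_mem_of_not_mem hz h0)
  rw [← hc z hz, mul_assoc, ← Real.rpow_add hz0, neg_add_cancel, Real.rpow_zero, mul_one]

theorem exists_eq_of_cauchyEuler (hI : IsOpen I) (hIc : IsPreconnected I) (h0 : (0 : ℝ) ∉ I)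
    (hqs : q ≠ s) (h₁ : ∀ z ∈ I, HasDerivAt φ (φ₁ z) z) (h₂ : ∀ z ∈ I, HasDerivAt φ₁ (φ₂ z) z)
    (hode : ∀ z ∈ I, z ^ 2 * φ₂ z = (q + s - 1) * z * φ₁ z - q * s * φ z) :
    ∃ b₁ b₂ : ℝ, ∀ z ∈ I, φ z = b₁ * |z| ^ q + b₂ * |z| ^ s := by
  obtain ⟨c₂, hc₂⟩ := exists_const_of_cauchyEuler hI hIc h0 h₁ h₂ hode
  obtain ⟨c₁, hc₁⟩ := exists_const_of_cauchyEuler (q := s) (s := q) hI hIc h0 h₁ h₂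
    fun z hz => by rw [hode z hz]; ring
  have hsub : s - q ≠ 0 := sub_ne_zero.2 hqs.symm
  refine ⟨-c₁ / (s - q), c₂ / (s - q), fun z hz => ?_⟩
  field_simp
  linear_combination hc₂ z hz - hc₁ z hz

end CauchyEuler

namespace Orthotoric

open Polynomial

section Euler

variable {I : Set ℝ} {φ φ₁ φ₂ : ℝ → ℝ} {p : ℝ}

theorem eulerOp_eq_of_hasDerivAt (hI : IsOpen I) (h₁ : ∀ z ∈ I, HasDerivAt φ (φ₁ z) z)
    {z d : ℝ} (hz : z ∈ I) (h₂ : HasDerivAt φ₁ d z) :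
    eulerOp p φ z = z ^ 2 * d - 2 * (p - 1) * z * φ₁ z + p * (p - 1) * φ z := by
  have h : deriv φ =ᶠ[nhds z] φ₁ :=
    Filter.eventually_of_mem (hI.mem_nhds hz) fun y hy => (h₁ y hy).deriv
  rw [eulerOp, h.deriv_eq, h₂.deriv, (h₁ z hz).deriv]

/-- The action of the Euler operator on polynomials. -/
def eulerPoly (p : ℝ) (P : ℝ[X]) : ℝ[X] :=
  X ^ 2 * derivative (derivative P) - C (2 * (p - 1)) * (X * derivative P) + C (p * (p - 1)) * P

theorem coeff_eulerPoly (p : ℝ) (P : ℝ[X]) (k : ℕ) :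
    (eulerPoly p P).coeff k = (k - p) * (k - p + 1) * P.coeff k := by
  have hfirst : (X * derivative P).coeff k = k * P.coeff k := by
    rcases k with _ | k
    · simp
    · rw [coeff_X_mul, coeff_derivative]
      push_cast
      ring
  have hsecond : (X ^ 2 * derivative (derivative P)).coeff k = k * (k - 1) * P.coeff k := by
    rcases k with _ | _ | k
    · simp
    · simp [pow_two, mul_assoc]
    · rw [coeff_X_pow_mul, coeff_derivative, coeff_derivative]
      push_cast
      ring
  rw [eulerPoly, coeff_add, coeff_sub, coeff_C_mul, coeff_C_mul, hfirst, hsecond]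
  ring

theorem natDegree_eulerPoly_le (p : ℝ) (P : ℝ[X]) :
    (eulerPoly p P).natDegree ≤ P.natDegree := by
  refine natDegree_le_iff_coeff_eq_zero.2 fun k hk => ?_
  rw [coeff_eulerPoly, coeff_eq_zero_of_natDegree_lt hk, mul_zero]

theorem exists_eulerPoly_eq {n : ℕ} (hp : ∀ k : ℕ, k ≤ n + 1 → p ≠ k) {R : ℝ[X]}
    (hR : R.natDegree ≤ n) : ∃ P : ℝ[X], P.natDegree ≤ n ∧ eulerPoly p P = R := by
  let P : ℝ[X] := ∑ i ∈ Finset.range (n + 1), monomial i (R.coeff i / ((i - p) * (i - p + 1)))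
  have hP (k : ℕ) :
      P.coeff k = if k ≤ n then R.coeff k / ((k - p) * (k - p + 1)) else 0 := by
    simp [P, coeff_monomial]
  refine ⟨P, natDegree_le_iff_coeff_eq_zero.2 fun k hk => ?_, ?_⟩
  · rw [hP, if_neg (by omega)]
  ext k
  rw [coeff_eulerPoly, hP]
  split_ifs with hk
  · have hroot : (k : ℝ) - p ≠ 0 := sub_ne_zero.2 (hp k (by omega)).symm
    have hroot' : (k : ℝ) - p + 1 ≠ 0 := fun h => hp (k + 1) (by omega) <| by
      push_cast
      linarith
    field_simp
  · rw [mul_zero, coeff_eq_zero_of_natDegree_lt (by omega)]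

theorem eval_eulerPoly (p : ℝ) (P : ℝ[X]) (z : ℝ) : (eulerPoly p P).eval z =
    z ^ 2 * P.derivative.derivative.eval z - 2 * (p - 1) * z * P.derivative.eval z +
      p * (p - 1) * P.eval z := by
  simp only [eulerPoly, eval_add, eval_sub, eval_mul, eval_C, eval_X, eval_pow]
  ring

theorem eulerOp_eq_eval (hI : IsOpen I) (h0 : (0 : ℝ) ∉ I) {P : ℝ[X]} {b₁ b₂ : ℝ}
    (hφ : ∀ z ∈ I, φ z = P.eval z + b₁ * |z| ^ (p - 1) + b₂ * |z| ^ p) {z : ℝ} (hz : z ∈ I) :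
    eulerOp p φ z = (eulerPoly p P).eval z := by
  have hne (y) (hy : y ∈ I) : y ≠ 0 := ne_of_mem_of_not_mem hy h0
  have hz0 := hne z hz
  have hfirst (y) (hy : y ∈ I) : HasDerivAt φ (P.derivative.eval y +
      b₁ * ((p - 1) * y⁻¹ * |y| ^ (p - 1)) + b₂ * (p * y⁻¹ * |y| ^ p)) y :=
    (((P.hasDerivAt y).add
      ((hasDerivAt_abs_rpow_of_ne_zero (p - 1) (hne y hy)).const_mul b₁)).add
      ((hasDerivAt_abs_rpow_of_ne_zero p (hne y hy)).const_mul b₂)).congr_of_eventuallyEq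
      (Filter.eventually_of_mem (hI.mem_nhds hy) hφ)
  have hsecond (q : ℝ) : HasDerivAt (fun z : ℝ => q * z⁻¹ * |z| ^ q)
      (q * (q - 1) * (z ^ 2)⁻¹ * |z| ^ q) z := by
    refine (((hasDerivAt_inv hz0).const_mul q).mul
      (hasDerivAt_abs_rpow_of_ne_zero q hz0)).congr_deriv ?_
    field_simp
    ring
  rw [eulerOp_eq_of_hasDerivAt hI hfirst hz (((P.derivative.hasDerivAt z).add
    ((hsecond (p - 1)).const_mul b₁)).add ((hsecond p).const_mul b₂)), eval_eulerPoly, hφ z hz]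
  field_simp
  ring

theorem exists_eq_of_eulerOp_eq (hI : IsOpen I) (hIc : IsPreconnected I) (h0 : (0 : ℝ) ∉ I)
    (h₁ : ∀ z ∈ I, HasDerivAt φ (deriv φ z) z)
    (h₂ : ∀ z ∈ I, HasDerivAt (deriv φ) (deriv (deriv φ) z) z) {P : ℝ[X]}
    (h : ∀ z ∈ I, eulerOp p φ z = (eulerPoly p P).eval z) :
    ∃ b₁ b₂ : ℝ, ∀ z ∈ I, φ z = P.eval z + b₁ * |z| ^ (p - 1) + b₂ * |z| ^ p := by
  obtain ⟨b₁, b₂, hb⟩ := exists_eq_of_cauchyEuler hI hIc h0 (sub_one_lt p).ne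
    (fun z hz => (h₁ z hz).sub (P.hasDerivAt z))
    (fun z hz => (h₂ z hz).sub (P.derivative.hasDerivAt z)) fun z hz => by
      have := h z hz
      rw [eulerOp, eval_eulerPoly] at this
      simp only [Pi.sub_apply]
      linear_combination this
  exact ⟨b₁, b₂, fun z hz => by
    rw [add_assoc, ← hb z hz, Pi.sub_apply, add_sub_cancel]⟩

end Euler

variable {m : ℕ} {Θ : Fin m → ℝ → ℝ} {D : Set (Pt m)} {x : Pt m}

section Separation

variable {W : Fin m → ℝ → ℝ} {c : ℝ} {b : Fin m → ℝ}

theorem eq_sq_mul_eval_sub {y : Pt m} {j : Fin m}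
    (hy : Function.Injective (xi y)) (h0 : sigma m y ≠ 0)
    (hW : -sigma m y ^ 2 * ∑ k, W k (xi y k) / (xi y k ^ 2 * Del k y) =
      c + ∑ r : Fin m, b r * sigma (r + 1) y) {L : ℝ[X]} (hL : L.degree < (m - 1 : ℕ))
    (hLW : ∀ k ≠ j, L.eval (xi y k) = W k (xi y k) / xi y k ^ 2) :
    W j (xi y j) = xi y j ^ 2 * L.eval (xi y j) -
      ((c + ∑ r : Fin m, b r * sigmaHat (r + 1) j y) +
        (∑ r : Fin m, b r * sigmaHat r j y) * xi y j) / sigmaHat (m - 1) j y ^ 2 * Del j y := by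
  have hξ := xi_ne_zero h0
  have hΔ := Del_ne_zero hy
  have he : sigmaHat (m - 1) j y ≠ 0 :=
    right_ne_zero_of_mul (xi_mul_sigmaHat_top j y ▸ h0)
  have hsum : ∑ k, W k (xi y k) / (xi y k ^ 2 * Del k y) =
      (W j (xi y j) - xi y j ^ 2 * L.eval (xi y j)) / (xi y j ^ 2 * Del j y) := by
    rw [← sub_zero (∑ k, _), ← sum_eval_div_Del hy hL, ← Finset.sum_sub_distrib,
      Finset.sum_eq_single j]
    · have := hξ j
      have := hΔ j
      field_simp
    · intro k _ hkj
      rw [hLW k hkj, div_div, sub_self]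
    · simp
  have hright : c + ∑ r : Fin m, b r * sigma (r + 1) y =
      (c + ∑ r : Fin m, b r * sigmaHat (r + 1) j y) +
        (∑ r : Fin m, b r * sigmaHat r j y) * xi y j := by
    simp only [sigma_succ_eq _ j, mul_add, Finset.sum_add_distrib, Finset.sum_mul, mul_assoc,
      add_assoc, mul_comm (xi y j)]
  rw [← hright, ← hW, hsum, ← xi_mul_sigmaHat_top j y]
  have := hξ j
  have := hΔ j
  field_simp
  ring

theorem sigmaHat_congr {j : Fin m} {y : Pt m} (hxy : ∀ k ≠ j, xi y k = xi x k) (r : ℕ) :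
    sigmaHat r j y = sigmaHat r j x := by
  rw [sigmaHat, Multiset.map_congr rfl fun k hk => hxy k (Finset.ne_of_mem_erase hk), sigmaHat]

theorem eval_nodal_eq_Del {j : Fin m} {y : Pt m} (hxy : ∀ k ≠ j, xi y k = xi x k) :
    (Lagrange.nodal (Finset.univ.erase j) (xi x)).eval (xi y j) = Del j y := by
  rw [Lagrange.eval_nodal, Del]
  exact Finset.prod_congr rfl fun k hk => by rw [hxy k (Finset.ne_of_mem_erase hk)]

/-- With the other coordinates held fixed, the polynomial is built from the Lagrange interpolant of
`W k (ξ_k) / ξ_k ^ 2`, `k ≠ j`, because `∑ k, L (ξ_k) / Δ_k = 0` for `deg L < m - 1`. -/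
theorem exists_polynomial_of_slice (hinj : ∀ x ∈ D, Function.Injective (xi x))
    (hσ : ∀ x ∈ D, sigma m x ≠ 0)
    (hW : ∀ x ∈ D, -sigma m x ^ 2 * ∑ k, W k (xi x k) / (xi x k ^ 2 * Del k x) =
      c + ∑ r : Fin m, b r * sigma (r + 1) x) (hm : 2 ≤ m) (hx : x ∈ D) (j : Fin m) :
    ∃ R : ℝ[X], R.natDegree ≤ m ∧ (∀ k, W k (xi x k) = R.eval (xi x k)) ∧
      ∀ y ∈ D, (∀ k ≠ j, xi y k = xi x k) → W j (xi y j) = R.eval (xi y j) := by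
  set s := Finset.univ.erase j with hs
  have hcard : s.card = m - 1 := by simp [hs]
  have hxs : Set.InjOn (xi x) s := (hinj x hx).injOn
  let L := Lagrange.interpolate s (xi x) fun k => W k (xi x k) / xi x k ^ 2
  let N := Lagrange.nodal s (xi x)
  let e := sigmaHat (m - 1) j x
  let α := c + ∑ r : Fin m, b r * sigmaHat (r + 1) j x
  let β := ∑ r : Fin m, b r * sigmaHat r j x
  have hL : L.degree < (m - 1 : ℕ) := hcard ▸ Lagrange.degree_interpolate_lt _ hxs
  have hLW (k) (hk : k ≠ j) : L.eval (xi x k) = W k (xi x k) / xi x k ^ 2 :=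
    Lagrange.eval_interpolate_at_node _ hxs (by simp [hs, hk])
  have hslice (y) (hy : y ∈ D) (hxy : ∀ k ≠ j, xi y k = xi x k) : W j (xi y j) =
      (X ^ 2 * L - C (e ^ 2)⁻¹ * (C α + C β * X) * N).eval (xi y j) := by
    have hN : N.eval (xi y j) = Del j y := eval_nodal_eq_Del hxy
    rw [eq_sq_mul_eval_sub (hinj y hy) (hσ y hy) (hW y hy) hL
      fun k hk => by rw [hxy k hk, hLW k hk]]
    simp only [sigmaHat_congr hxy, eval_sub, eval_mul, eval_add, eval_pow, eval_X, eval_C, hN]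
    ring
  refine ⟨_, ?_, fun k => ?_, hslice⟩
  · have hLdeg : L.natDegree ≤ m - 2 := natDegree_le_iff_coeff_eq_zero.2 fun k hk =>
      (degree_lt_iff_coeff_zero _ _).1 hL k (by omega)
    have hNdeg : N.natDegree ≤ m - 1 := (Lagrange.natDegree_nodal.trans hcard).le
    compute_degree
    omega
  · rcases eq_or_ne k j with rfl | hk
    · exact hslice x hx fun _ _ => rfl
    · have hξ := xi_ne_zero (hσ x hx) k
      have hN : N.eval (xi x k) = 0 := Lagrange.eval_nodal_at_node (by simp [hs, hk])
      simp only [eval_sub, eval_mul, eval_pow, eval_X, hLW k hk, hN, mul_zero, sub_zero]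
      field_simp

theorem eq_of_eventually_eval_eq {P Q : ℝ[X]} {z : ℝ}
    (h : ∀ᶠ y in nhds z, P.eval y = Q.eval y) : P = Q :=
  eq_of_infinite_eval_eq P Q (infinite_of_mem_nhds z h)

theorem exists_polynomial_eval_eq (hm : 2 ≤ m) (hD : IsOpen D) (hDc : IsPreconnected D)
    (hinj : ∀ x ∈ D, Function.Injective (xi x)) (hσ : ∀ x ∈ D, sigma m x ≠ 0)
    (hW : ∀ x ∈ D, -sigma m x ^ 2 * ∑ k, W k (xi x k) / (xi x k ^ 2 * Del k x) =
      c + ∑ r : Fin m, b r * sigma (r + 1) x) :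
    ∃ R : ℝ[X], R.natDegree ≤ m ∧ ∀ x ∈ D, ∀ j, W j (xi x j) = R.eval (xi x j) := by
  rcases D.eq_empty_or_nonempty with rfl | ⟨x₀, hx₀⟩
  · exact ⟨0, by simp, by simp⟩
  let j : Fin m := ⟨0, by omega⟩
  have hex (x) (hx : x ∈ D) := exists_polynomial_of_slice hinj hσ hW hm hx j
  choose! R hdeg hR hslice using hex
  have hgerm (x) (hx : x ∈ D) : ∀ᶠ z in nhds (xi x j), W j z = (R x).eval z := by
    have hcont : Filter.Tendsto (Function.update x (Sum.inl j)) (nhds (xi x j)) (nhds x) := by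
      have := (continuous_const.update (Sum.inl j) continuous_id :
        Continuous (Function.update x (Sum.inl j))).tendsto (xi x j)
      rwa [xi, Function.update_eq_self] at this
    filter_upwards [hcont (hD.mem_nhds hx)] with z hz
    simpa [xi] using hslice x hx _ hz fun k hk => by simp [xi, hk]
  have hlocal (x) (hx : x ∈ D) : ∀ᶠ y in nhdsWithin x D, R x = R y := by
    have hcont : Continuous fun y : Pt m => xi y j := (contDiff_xi j).continuous
    filter_upwards [self_mem_nhdsWithin, nhdsWithin_le_nhds <|
      (hcont.tendsto x).eventually (hgerm x hx).eventually_nhds] with y hy hxy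
    refine eq_of_eventually_eval_eq (z := xi y j) ?_
    filter_upwards [hxy, hgerm y hy] with z hxz hyz
    rw [← hxz, hyz]
  have hconst (x) (hx : x ∈ D) : R x₀ = R x :=
    hDc.induction₂ (fun x y => R x = R y) hlocal (fun _ _ _ _ _ _ h h' => h.trans h')
      (fun _ _ _ _ h => h.symm) hx₀ hx
  exact ⟨R x₀, hdeg x₀ hx₀, fun x hx => hconst x hx ▸ hR x hx⟩

end Separation

variable {p : ℝ}

theorem eq_zero_of_sum_sigma_eq_const {b : Fin m → ℝ} {c : ℝ} {x : Pt m} (hD : IsOpen D)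
    (hx : x ∈ D) (hinj : Function.Injective (xi x))
    (h : ∀ y ∈ D, ∑ r : Fin m, b r * sigma (r + 1) y = c) : b = 0 :=
  funext <| eq_zero_of_sum_sigmaHat hinj fun j => by
    rw [← (hasPd_sum_sigma b j x).pd_eq, pd_congr_of_eqOn hD hx h, pd_const]

theorem exists_sum_sigma_eq (hm : 2 ≤ m) (c₁ c₂ : ℝ) :
    ∃ b : Fin m → ℝ, (b = 0 → c₁ = 0 ∧ c₂ = 0) ∧
      ∀ x : Pt m, ∑ r : Fin m, b r * sigma (r + 1) x = c₁ * sigma (m - 1) x + c₂ * sigma m x := by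
  obtain ⟨n, rfl⟩ := Nat.exists_eq_add_of_le' hm
  refine ⟨Pi.single (Fin.last n).castSucc c₁ + Pi.single (Fin.last (n + 1)) c₂, fun hb => ?_,
    fun x => ?_⟩
  · exact ⟨by simpa using congrFun hb (Fin.last n).castSucc,
      by simpa using congrFun hb (Fin.last (n + 1))⟩
  · simp [Pi.single_apply, add_mul, Finset.sum_add_distrib]

namespace IsOrthotoric

theorem exists_hasForm (h : IsOrthotoric Θ D) (hDc : IsPreconnected D)
    (hσ : ∀ x ∈ D, sigma m x ≠ 0) {P : ℝ[X]}
    (hP : ∀ x ∈ D, ∀ j, eulerOp p (Θ j) (xi x j) = (eulerPoly p P).eval (xi x j)) :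
    ∃ b₁ b₂ : Fin m → ℝ, HasForm Θ D p P b₁ b₂ := by
  have hsol (j) := exists_eq_of_eulerOp_eq (h.isOpen_image j)
    (hDc.image _ (contDiff_xi j).continuous.continuousOn)
    (fun ⟨y, hy, hy0⟩ => xi_ne_zero (hσ y hy) j hy0) (fun _ => h.hasDerivAt_Theta)
    (fun _ => h.hasDerivAt_deriv_Theta) (Set.forall_mem_image.2 fun y hy => hP y hy j)
  choose b₁ b₂ hb using hsol
  exact ⟨b₁, b₂, hb⟩

theorem exists_hasForm_of_isKillingPotential (h : IsOrthotoric Θ D) (hm : 2 ≤ m)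
    (hp : ∀ k : ℕ, k ≤ m + 1 → p ≠ k) (hDc : IsPreconnected D) (hσ : ∀ x ∈ D, sigma m x ≠ 0)
    (hext : IsKillingPotential (metric Θ) kahlerForm D (weightedScal (metric Θ) (sigma m) p)) :
    ∃ P : ℝ[X], P.natDegree ≤ m ∧ ∃ b₁ b₂ : Fin m → ℝ, HasForm Θ D p P b₁ b₂ := by
  obtain ⟨c, b, hcb⟩ := h.eq_sum_of_isKillingPotential hDc
    (fun a => (invariantAlong_metric Θ a).weightedScal (invariantAlong_sigma m a) p) hext
  obtain ⟨R, hR, hRΘ⟩ := exists_polynomial_eval_eq (W := fun j => eulerOp p (Θ j)) hm h.isOpen hDc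
    h.inj hσ fun x hx => by rw [← h.weightedScal_eq p hx (hσ x hx), hcb x hx]
  obtain ⟨P, hP, rfl⟩ := exists_eulerPoly_eq hp hR
  exact ⟨P, hP, h.exists_hasForm hDc hσ hRΘ⟩

variable {P : ℝ[X]} {b₁ b₂ : Fin m → ℝ}

theorem weightedScal_of_hasForm (h : IsOrthotoric Θ D) (hm : 2 ≤ m)
    (hσ : ∀ x ∈ D, sigma m x ≠ 0) (hP : P.natDegree ≤ m) (hform : HasForm Θ D p P b₁ b₂)
    {x : Pt m} (hx : x ∈ D) :
    weightedScal (metric Θ) (sigma m) p x =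
      (-1) ^ m * (p * (p - 1) * P.coeff 0) * sigma (m - 1) x +
        (-1) ^ m * ((p - 1) * (p - 2) * P.coeff 1) * sigma m x := by
  have heuler (j : Fin m) : eulerOp p (Θ j) (xi x j) = (eulerPoly p P).eval (xi x j) :=
    eulerOp_eq_eval (h.isOpen_image j) (fun ⟨y, hy, hy0⟩ => xi_ne_zero (hσ y hy) j hy0) (hform j)
      ⟨x, hx, rfl⟩
  rw [h.weightedScal_eq p hx (hσ x hx)]
  simp only [heuler, neg_mul, sum_eval_div hm (h.inj x hx) (hσ x hx)
    ((natDegree_eulerPoly_le p P).trans hP), coeff_eulerPoly]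
  push_cast
  ring

theorem isWeightedExtremal_of_hasForm (h : IsOrthotoric Θ D) (hm : 2 ≤ m)
    (hσ : ∀ x ∈ D, sigma m x ≠ 0) (hP : P.natDegree ≤ m) (hform : HasForm Θ D p P b₁ b₂) :
    IsWeightedExtremal (metric Θ) kahlerForm D (sigma m) p := by
  have hkill (u : Pt m → ℝ) (c₁ c₂ : ℝ)
      (hu : ∀ x ∈ D, u x = c₁ * sigma (m - 1) x + c₂ * sigma m x) :
      IsKillingPotential (metric Θ) kahlerForm D u := by
    obtain ⟨b, -, hb⟩ := exists_sum_sigma_eq hm c₁ c₂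
    exact isKillingPotential_of_eq_sum h.isOpen fun x hx => by rw [hu x hx, ← hb x, zero_add]
  exact ⟨hkill _ 0 1 fun x _ => by ring,
    hkill _ _ _ fun x hx => h.weightedScal_of_hasForm hm hσ hP hform hx⟩

theorem eval_zero_eq_zero_of_weightedScal_eq_const (h : IsOrthotoric Θ D) (hm : 2 ≤ m)
    (hp : ∀ k : ℕ, k ≤ m + 1 → p ≠ k) (hD : D.Nonempty) (hσ : ∀ x ∈ D, sigma m x ≠ 0)
    (hP : P.natDegree ≤ m) (hform : HasForm Θ D p P b₁ b₂) {c : ℝ}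
    (hc : ∀ x ∈ D, weightedScal (metric Θ) (sigma m) p x = c) :
    P.eval 0 = 0 ∧ P.derivative.eval 0 = 0 := by
  obtain ⟨x, hx⟩ := hD
  obtain ⟨b, hb, hsum⟩ := exists_sum_sigma_eq hm ((-1) ^ m * (p * (p - 1) * P.coeff 0))
    ((-1) ^ m * ((p - 1) * (p - 2) * P.coeff 1))
  obtain ⟨h₀, h₁⟩ := hb <| eq_zero_of_sum_sigma_eq_const h.isOpen hx (h.inj x hx) fun y hy => by
    rw [hsum, ← h.weightedScal_of_hasForm hm hσ hP hform hy, hc y hy]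
  have hp0 : p ≠ 0 := by simpa using hp 0 (by omega)
  have hp1 : p - 1 ≠ 0 := sub_ne_zero.2 (by simpa using hp 1 (by omega))
  have hp2 : p - 2 ≠ 0 := sub_ne_zero.2 (by simpa using hp 2 (by omega))
  rw [← coeff_zero_eq_eval_zero, ← coeff_zero_eq_eval_zero, coeff_derivative]
  simp_all

theorem weightedScal_eq_zero_of_eval_zero_eq_zero (h : IsOrthotoric Θ D) (hm : 2 ≤ m)
    (hσ : ∀ x ∈ D, sigma m x ≠ 0) (hP : P.natDegree ≤ m) (hform : HasForm Θ D p P b₁ b₂)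
    (h0 : P.eval 0 = 0 ∧ P.derivative.eval 0 = 0) {x : Pt m} (hx : x ∈ D) :
    weightedScal (metric Θ) (sigma m) p x = 0 := by
  rw [← coeff_zero_eq_eval_zero, ← coeff_zero_eq_eval_zero, coeff_derivative] at h0
  simp_all [h.weightedScal_of_hasForm hm hσ hP hform hx]

end IsOrthotoric

end Orthotoric

end

theorem propositionA2_general (m : ℕ) (hm : 2 ≤ m) (p : ℝ) (hp : ∀ k : ℕ, k ≤ m + 1 → p ≠ k)
    (D : Set (Pt m)) (hDo : IsOpen D) (hDc : IsConnected D)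
    (Θ : Fin m → ℝ → ℝ)
    (hΘ : ∀ j, ContDiffOn ℝ ∞ (Θ j) ((fun x : Pt m => xi x j) '' D))
    (hinj : ∀ x ∈ D, Function.Injective (xi x))
    (hne : ∀ x ∈ D, ∀ j, Θ j (xi x j) ≠ 0)
    (hσ : ∀ x ∈ D, sigma m x ≠ 0) :
    (IsWeightedExtremal (metric Θ) kahlerForm D (sigma m) p ↔
      ∃ P : Polynomial ℝ, P.natDegree ≤ m ∧ ∃ b₁ b₂ : Fin m → ℝ, HasForm Θ D p P b₁ b₂) ∧
    ∀ (P : Polynomial ℝ) (b₁ b₂ : Fin m → ℝ), P.natDegree ≤ m → HasForm Θ D p P b₁ b₂ →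
      (∃ c₁ c₂ : ℝ, ∀ x ∈ D,
        weightedScal (metric Θ) (sigma m) p x = c₁ * sigma (m - 1) x + c₂ * sigma m x) ∧
      ((∃ c : ℝ, ∀ x ∈ D, weightedScal (metric Θ) (sigma m) p x = c) ↔
        ∀ x ∈ D, weightedScal (metric Θ) (sigma m) p x = 0) ∧
      ((∀ x ∈ D, weightedScal (metric Θ) (sigma m) p x = 0) ↔
        P.eval 0 = 0 ∧ P.derivative.eval 0 = 0) := by
  have h : IsOrthotoric Θ D := ⟨hDo, hΘ, hinj, hne⟩
  refine ⟨⟨fun hext => h.exists_hasForm_of_isKillingPotential hm hp hDc.isPreconnected hσ hext.2,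
    fun ⟨P, hP, b₁, b₂, hform⟩ => h.isWeightedExtremal_of_hasForm hm hσ hP hform⟩,
    fun P b₁ b₂ hP hform => ?_⟩
  have heval {c : ℝ} (hc : ∀ x ∈ D, weightedScal (metric Θ) (sigma m) p x = c) :
      P.eval 0 = 0 ∧ P.derivative.eval 0 = 0 :=
    h.eval_zero_eq_zero_of_weightedScal_eq_const hm hp hDc.nonempty hσ hP hform hc
  have hzero (h0 : P.eval 0 = 0 ∧ P.derivative.eval 0 = 0) :
      ∀ x ∈ D, weightedScal (metric Θ) (sigma m) p x = 0 := fun x =>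
    h.weightedScal_eq_zero_of_eval_zero_eq_zero hm hσ hP hform h0
  exact ⟨⟨_, _, fun x hx => h.weightedScal_of_hasForm hm hσ hP hform hx⟩,
    ⟨fun ⟨_, hc⟩ => hzero (heval hc), fun h0 => ⟨0, h0⟩⟩, heval, hzero⟩

theorem propositionA2 (m : ℕ) (hm : 2 ≤ m) (p : ℝ) (hp : ∀ k : ℕ, k ≤ m + 1 → p ≠ k)
    (D : Set (Pt m)) (hDo : IsOpen D) (hDc : IsConnected D)
    (Θ : Fin m → ℝ → ℝ)
    (hΘ : ∀ j, ContDiffOn ℝ ∞ (Θ j) ((fun x : Pt m => xi x j) '' D))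
    (hinj : ∀ x ∈ D, Function.Injective (xi x))
    (hpos : ∀ x ∈ D, ∀ j, 0 < Θ j (xi x j) / Del j x)
    (hσ : ∀ x ∈ D, sigma m x ≠ 0) :
    (IsWeightedExtremal (metric Θ) kahlerForm D (sigma m) p ↔
      ∃ P : Polynomial ℝ, P.natDegree ≤ m ∧ ∃ b₁ b₂ : Fin m → ℝ, HasForm Θ D p P b₁ b₂) ∧
    ∀ (P : Polynomial ℝ) (b₁ b₂ : Fin m → ℝ), P.natDegree ≤ m → HasForm Θ D p P b₁ b₂ →
      (∃ c₁ c₂ : ℝ, ∀ x ∈ D,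
        weightedScal (metric Θ) (sigma m) p x = c₁ * sigma (m - 1) x + c₂ * sigma m x) ∧
      ((∃ c : ℝ, ∀ x ∈ D, weightedScal (metric Θ) (sigma m) p x = c) ↔
        ∀ x ∈ D, weightedScal (metric Θ) (sigma m) p x = 0) ∧
      ((∀ x ∈ D, weightedScal (metric Θ) (sigma m) p x = 0) ↔
        P.eval 0 = 0 ∧ P.derivative.eval 0 = 0) :=
  propositionA2_general m hm p hp D hDo hDc Θ hΘ hinj
    (fun x hx j => (div_ne_zero_iff.1 (hpos x hx j).ne').1) hσ
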